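/- **Setting.** Let $G$ be a finite connected simple undirected graph with $n\ge 2$ vertices, graph distance $d$, diameter $\operatorname{diam}(G)$ and maximum degree $\Delta(G)$. A cop and a robber start at vertices $c$ and $r$. Let $y_t$ and $x_t$ be the positions of the cop and the robber after $t$ moves. In move $t+1$ the cop, who sees everything, first steps from $y_t$ to an adjacent vertex $y_{t+1}$; then the robber steps from $x_t$ to a vertex $x_{t+1}$ which, given everything that has happened so far (including the cop's latest step), is uniformly distributed on the neighbours of $x_t$. The capture time $T$ is the number of the first move in which the cop lands on the robber's vertex or the robber on the cop's ($T=0$ if $r=c$). **The four-stage strategy.** Until the capture, the cop moves as follows. 1. For the first $s_1=d(c,r)$ moves she walks along a geodesic to the robber's initial position $x_0=r$. 2. For the next $d(y_{s_1},x_{s_1})$ moves she walks along a geodesic to $x_{s_1}$, the robber's position at the end of Stage 1. Let $s_2=s_1+d(y_{s_1},x_{s_1})$. 3. For $i=0,1,2,\dots$, as long as $d(y_{s_2+4i},x_{s_2+4i})\ge 4$, she takes $x_{s_2+4i}$ as her target and makes her next four steps along a geodesic towards it. 4. From the first $i$ with $d(y_{s_2+4i},x_{s_2+4i})\le 3$ on,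 she plays greedily: in each move she steps to a neighbour of her current vertex that is at minimal distance from the robber's current vertex. Ties (between geodesics or between greedy steps) may be broken in any way, possibly depending on the past and on additional randomness. **Theorem.** There is a function $f:\mathbb N\to\mathbb R$ with $f(n)=o(n)$ such that for every connected simple undirected graph $G$ on $n\ge2$ vertices, all starting vertices $c,r$, and every cop who uses the four-stage strategy, $$\mathbb E[T]\le \operatorname{diam}(G)+\Delta(G)+f(n)\qquad\text{and}\qquad \mathbb E[T]\le n+f(n).$$ -/

import Mathlib

open MeasureTheory Filter Asymptotics
open scoped ENNReal

namespace DrunkRobber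

/-! A play is described by `x y : ℕ → V`: `x t` and `y t` are the positions of the robber and of the
cop after `t` moves. In move `t + 1` the cop first steps from `y t` to `y (t + 1)` while the robber
is on `x t`; then the robber steps from `x t` to `x (t + 1)`. -/

/-- The robber is caught at move `t`: the cop has landed on the robber's vertex, or the robber on
the cop's. At `t = 0` this means that both start on the same vertex. -/
def CaughtAt {V : Type*} (x y : ℕ → V) (t : ℕ) : Prop :=
  x t = y t ∨ ∃ s, t = s + 1 ∧ y (s + 1) = x s

/-- The robber is still free after `t` moves. -/
def FreeAt {V : Type*} (x y : ℕ → V) (t : ℕ) : Prop :=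
  ∀ s ≤ t, ¬ CaughtAt x y s

/-- The number of the first move at which the robber is caught (`⊤` if he never is). -/
noncomputable def captureTime {V : Type*} (x y : ℕ → V) : ℕ∞ :=
  ⨅ (t : ℕ) (_ : CaughtAt x y t), (t : ℕ∞)

/-- A step from `a` to an adjacent vertex `b` along a geodesic from `a` to `w`. -/
def StepsToward {V : Type*} (G : SimpleGraph V) (a b w : V) : Prop :=
  G.Adj a b ∧ G.dist b w + 1 = G.dist a w

/-- A greedy step from `a` to an adjacent vertex `b`: among all the neighbours of `a`, `b` is at
minimal distance from `w`. -/
def GreedyStep {V : Type*} (G : SimpleGraph V) (a b w : V) : Prop :=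
  G.Adj a b ∧ ∀ c, G.Adj a c → G.dist b w ≤ G.dist c w

/-- The number of moves after which Stage 1 ends: the initial distance of the players. -/
noncomputable def stage1End {V : Type*} (G : SimpleGraph V) (x y : ℕ → V) : ℕ :=
  G.dist (y 0) (x 0)

/-- The number of moves after which Stage 2 ends: Stage 2 lasts as many moves as the distance of
the players at the end of Stage 1. -/
noncomputable def stage2End {V : Type*} (G : SimpleGraph V) (x y : ℕ → V) : ℕ :=
  stage1End G x y + G.dist (y (stage1End G x y)) (x (stage1End G x y))

/-- Stage 3 has not terminated when it is the cop's turn after `t` moves: at each retargeting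
moment so far (every fourth move, counted from the end of Stage 2) the players were at distance at
least `4`. -/
def StillRetargeting {V : Type*} (G : SimpleGraph V) (x y : ℕ → V) (t : ℕ) : Prop :=
  ∀ i : ℕ, stage2End G x y + 4 * i ≤ t →
    4 ≤ G.dist (y (stage2End G x y + 4 * i)) (x (stage2End G x y + 4 * i))

/-- Until the capture, the cop's moves in the play `x, y` obey the four-stage strategy.
Ties (between geodesics, or between equally good greedy steps) may be broken in any way. -/
structure FollowsFourStages {V : Type*} (G : SimpleGraph V) (x y : ℕ → V) : Prop where
  /-- Stage 1: walk along a geodesic to the robber's initial position. -/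
  stage1 : ∀ t, FreeAt x y t → t < stage1End G x y →
    StepsToward G (y t) (y (t + 1)) (x 0)
  /-- Stage 2: walk along a geodesic to the robber's position at the end of Stage 1. -/
  stage2 : ∀ t, FreeAt x y t → stage1End G x y ≤ t → t < stage2End G x y →
    StepsToward G (y t) (y (t + 1)) (x (stage1End G x y))
  /-- Stage 3: in each block of four moves, walk along a geodesic to the position that the robber
  had at the beginning of the block. -/
  stage3 : ∀ t, FreeAt x y t → stage2End G x y ≤ t → StillRetargeting G x y t →
    StepsToward G (y t) (y (t + 1)) (x (stage2End G x y + 4 * ((t - stage2End G x y) / 4)))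
  /-- Stage 4: from the first retargeting moment with distance at most `3` on, play greedily. -/
  stage4 : ∀ t, FreeAt x y t → stage2End G x y ≤ t → ¬ StillRetargeting G x y t →
    GreedyStep G (y t) (y (t + 1)) (x t)

/-- Transition probabilities of the simple random walk. -/
noncomputable def stepProb {V : Type*} [Fintype V] (G : SimpleGraph V) [DecidableRel G.Adj]
    (a b : V) : ℝ≥0∞ :=
  if G.Adj a b then (G.degree a : ℝ≥0∞)⁻¹ else 0

/-- The event that the robber's first `t` moves and the cop's first `t + 1` moves follow `x`, `y`:
all that has happened just before the robber's step in move `t + 1`. -/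
def history {V Ω : Type*} (X Y : ℕ → Ω → V) (t : ℕ) (x y : ℕ → V) : Set Ω :=
  {ω | (∀ s ≤ t, X s ω = x s) ∧ (∀ s ≤ t + 1, Y s ω = y s)}

/-- On a probability space, `X` and `Y` are the positions of a drunk robber starting at `r` and of
a cop starting at `c`: given everything that has happened before, including the cop's latest step,
the robber steps to a uniformly random neighbour. The cop may act on the past and on randomness of
her own, but not on the robber's future. -/
structure IsDrunkGame {V Ω : Type*} [Fintype V] (G : SimpleGraph V) [DecidableRel G.Adj]
    [MeasurableSpace Ω] (P : Measure Ω) (X Y : ℕ → Ω → V) (r c : V) : Prop where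
  measurable_robber : ∀ t a, MeasurableSet {ω | X t ω = a}
  measurable_cop : ∀ t a, MeasurableSet {ω | Y t ω = a}
  robber_start : ∀ ω, X 0 ω = r
  cop_start : ∀ ω, Y 0 ω = c
  robber_step : ∀ (t : ℕ) (x y : ℕ → V) (b : V),
    P (history X Y t x y ∩ {ω | X (t + 1) ω = b}) = P (history X Y t x y) * stepProb G (x t) b

/-- The expected capture time. -/
noncomputable def expectedCaptureTime {V Ω : Type*} [MeasurableSpace Ω] (P : Measure Ω)
    (X Y : ℕ → Ω → V) : ℝ≥0∞ :=
  ∫⁻ ω, ((captureTime (fun t => X t ω) (fun t => Y t ω) : ℕ∞) : ℝ≥0∞) ∂P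

end DrunkRobber

namespace DrunkRobber

/-! Two facts hold for simple random walk on every connected graph with `n ≥ 2` vertices. The walk
is diffusive: for every `s > 0` its expected displacement in `t` steps is at most `(log n + 1) / s +
8 s t + 1`, so of order `√t log n` for `s = t ^ (-1/2)` (`walkAvg_iterate_dist_le`). And after four
steps it is within distance three of its start with probability at least `(3/7) n ^ (-2/3)`
(`walkAvg_iterate_four_ballInd_ge`).

Stage 1 takes at most `diam G` moves, in which the robber drifts by about `√n`; this is the length
of Stage 2, in which he drifts by about `n ^ (1/4)`; this is the distance at which Stage 3 starts
(all up to logarithms). In a block of Stage 3 the cop gains four and the robber gives back at most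
four, and at most three with probability of order `n ^ (-2/3)`. Hence the expected number of blocks
is about `n ^ (1/4 + 2/3) = n ^ (11/12)`, which is `o(n)` with the logarithm
(`sum_retarget_gain_le`).

In Stage 4 the distance stays at most three when the cop is to move. After a greedy step that
misses, some neighbour of the robber is within one of the cop; he steps to such a vertex with
probability at least `1 / Δ`, and the next greedy step catches him (`sum_survivesGreedy_near_le`).
This costs `Δ + 1` moves in expectation. Adding the stages (`sum_freeAt_le`) gives `diam + Δ +
o(n)`, and `diam + Δ ≤ n + 2` (`diam_add_maxDegree_le`) gives the second bound. -/

theorem abs_dist_sub_dist_le {V : Type*} {G : SimpleGraph V} (hG : G.Connected) (x : V) {a b : V}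
    (h : G.Adj a b) :
    |(G.dist x b : ℝ) - G.dist x a| ≤ 1 := by
  have h1 : G.dist x b ≤ G.dist x a + 1 := by
    have := hG.dist_triangle (u := x) (v := a) (w := b)
    rwa [SimpleGraph.dist_eq_one_iff_adj.2 h] at this
  have h2 : G.dist x a ≤ G.dist x b + 1 := by
    have := hG.dist_triangle (u := x) (v := b) (w := a)
    rwa [SimpleGraph.dist_eq_one_iff_adj.2 h.symm] at this
  have h1' : (G.dist x b : ℝ) ≤ G.dist x a + 1 := by exact_mod_cast h1
  have h2' : (G.dist x a : ℝ) ≤ G.dist x b + 1 := by exact_mod_cast h2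
  exact abs_le.2 ⟨by linarith, by linarith⟩

/-! ### Diffusive displacement of the simple random walk -/

section WalkAverage

variable {V : Type*} [Fintype V] (G : SimpleGraph V) [DecidableRel G.Adj]

/-- The average of `f` over the neighbours of `a`: the transition operator of the simple random
walk. -/
noncomputable def walkAvg (f : V → ℝ) (a : V) : ℝ :=
  (∑ b ∈ G.neighborFinset a, f b) / G.degree a

variable {G}

theorem walkAvg_mono {f g : V → ℝ} {a : V} (h : ∀ b, G.Adj a b → f b ≤ g b) :
    walkAvg G f a ≤ walkAvg G g a := by
  unfold walkAvg
  gcongr with b hb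
  exact h b (by simpa using hb)

theorem walkAvg_congr {f g : V → ℝ} {a : V} (h : ∀ b, G.Adj a b → f b = g b) :
    walkAvg G f a = walkAvg G g a :=
  le_antisymm (walkAvg_mono fun b hb => (h b hb).le) (walkAvg_mono fun b hb => (h b hb).ge)

theorem walkAvg_nonneg {f : V → ℝ} {a : V} (h : ∀ b, G.Adj a b → 0 ≤ f b) :
    0 ≤ walkAvg G f a :=
  div_nonneg (Finset.sum_nonneg fun b hb => h b (by simpa using hb)) (Nat.cast_nonneg _)

theorem walkAvg_add (f g : V → ℝ) (a : V) :
    walkAvg G (fun b => f b + g b) a = walkAvg G f a + walkAvg G g a := by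
  simp only [walkAvg, Finset.sum_add_distrib, add_div]

theorem walkAvg_const_mul (k : ℝ) (f : V → ℝ) (a : V) :
    walkAvg G (fun b => k * f b) a = k * walkAvg G f a := by
  simp only [walkAvg, ← Finset.mul_sum, mul_div_assoc]

theorem walkAvg_const {a : V} (ha : 0 < G.degree a) (k : ℝ) : walkAvg G (fun _ => k) a = k := by
  have : (G.degree a : ℝ) ≠ 0 := by positivity
  simp only [walkAvg, Finset.sum_const, nsmul_eq_mul, SimpleGraph.card_neighborFinset_eq_degree]
  field_simp

theorem degree_mul_walkAvg (f : V → ℝ) (a : V) :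
    G.degree a * walkAvg G f a = ∑ b ∈ G.neighborFinset a, f b := by
  unfold walkAvg
  rcases Nat.eq_zero_or_pos (G.degree a) with h | h
  · have : G.neighborFinset a = ∅ := by
      rw [← Finset.card_eq_zero, SimpleGraph.card_neighborFinset_eq_degree, h]
    simp [h, this]
  · field_simp

theorem walkAvg_iterate_mono {f g : V → ℝ} (h : ∀ b, f b ≤ g b) (t : ℕ) (a : V) :
    (walkAvg G)^[t] f a ≤ (walkAvg G)^[t] g a := by
  induction t generalizing a with
  | zero => exact h a
  | succ t ih =>
    simp only [Function.iterate_succ_apply']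
    exact walkAvg_mono fun b _ => ih b

theorem walkAvg_iterate_nonneg {f : V → ℝ} (h : ∀ b, 0 ≤ f b) (t : ℕ) (a : V) :
    0 ≤ (walkAvg G)^[t] f a := by
  induction t generalizing a with
  | zero => exact h a
  | succ t ih =>
    simp only [Function.iterate_succ_apply']
    exact walkAvg_nonneg fun b _ => ih b

theorem walkAvg_iterate_affine (hdeg : ∀ a, 0 < G.degree a) (k l : ℝ) (f : V → ℝ) (t : ℕ) (a : V) :
    (walkAvg G)^[t] (fun b => k * f b + l) a = k * (walkAvg G)^[t] f a + l := by
  induction t generalizing a with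
  | zero => rfl
  | succ t ih =>
    simp only [Function.iterate_succ_apply']
    rw [walkAvg_congr fun b _ => ih b, walkAvg_add, walkAvg_const_mul, walkAvg_const (hdeg a)]

theorem sum_neighborFinset_comm (F : V → V → ℝ) :
    ∑ a, ∑ b ∈ G.neighborFinset a, F a b = ∑ b, ∑ a ∈ G.neighborFinset b, F a b :=
  Finset.sum_comm' fun a b => by simp [G.adj_comm]

theorem sq_walkAvg_mul_le (f g : V → ℝ) (a : V) :
    (walkAvg G (fun b => f b * g b) a) ^ 2 ≤
      walkAvg G (fun b => f b ^ 2) a * walkAvg G (fun b => g b ^ 2) a := by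
  unfold walkAvg
  rw [div_pow, div_mul_div_comm, ← sq]
  gcongr
  exact Finset.sum_mul_sq_le_sq_mul_sq _ _ _

/-- For a centred variable the linear term averages to zero, which leaves a purely quadratic
exponent. -/
theorem exp_le_add_exp_sq (x : ℝ) : Real.exp x ≤ x + Real.exp (x ^ 2) := by
  have h2 := Real.add_one_le_exp (x ^ 2)
  rcases le_total x 1 with h1 | h1
  · rcases le_total (-1) x with h0 | h0
    · have := abs_le.1 (Real.abs_exp_sub_one_sub_id_le (abs_le.2 ⟨h0, h1⟩))
      linarith [this.2]
    · have : Real.exp x ≤ 1 := Real.exp_le_one_iff.2 (by linarith)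
      nlinarith
  · have : Real.exp x ≤ Real.exp (x ^ 2) := Real.exp_le_exp.2 (by nlinarith)
    linarith

/-- A crude form of Hoeffding's lemma for the step of the walk. -/
theorem walkAvg_exp_centered_le {a : V} (ha : 0 < G.degree a) {φ : V → ℝ}
    (hφ : ∀ b, G.Adj a b → |φ b - φ a| ≤ 1) (u : ℝ) :
    walkAvg G (fun b => Real.exp (u * (φ b - walkAvg G φ a))) a ≤ Real.exp (4 * u ^ 2) := by
  set m := walkAvg G φ a with hm
  have hm' : |m - φ a| ≤ 1 := by
    have h1 : m ≤ φ a + 1 := by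
      rw [← walkAvg_const ha (φ a + 1)]
      exact walkAvg_mono fun b hb => by linarith [(abs_le.1 (hφ b hb)).2]
    have h2 : φ a - 1 ≤ m := by
      rw [← walkAvg_const ha (φ a - 1)]
      exact walkAvg_mono fun b hb => by linarith [(abs_le.1 (hφ b hb)).1]
    exact abs_le.2 ⟨by linarith, by linarith⟩
  calc walkAvg G (fun b => Real.exp (u * (φ b - m))) a
      ≤ walkAvg G (fun b => u * φ b + (Real.exp (4 * u ^ 2) - u * m)) a := by
        refine walkAvg_mono fun b hb => (exp_le_add_exp_sq _).trans ?_
        -- Both `φ b` and the mean `m` are within one of `φ a`.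
        have h3 : (φ b - m) ^ 2 ≤ 4 := by
          have := abs_le.1 (hφ b hb)
          have := abs_le.1 hm'
          nlinarith
        have : Real.exp ((u * (φ b - m)) ^ 2) ≤ Real.exp (4 * u ^ 2) :=
          Real.exp_le_exp.2 (by rw [mul_pow]; nlinarith [sq_nonneg u])
        linarith
    _ = Real.exp (4 * u ^ 2) := by
        rw [walkAvg_add, walkAvg_const_mul, walkAvg_const ha, ← hm]; ring

/-- Cauchy–Schwarz separates the weight from `f`. The squared weight is an exponential with
parameter `2 * s`, and reversibility preserves the degree-weighted sum of `f ^ 2`. -/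
theorem sum_degree_mul_sq_tilt_right_le (hdeg : ∀ a, 0 < G.degree a) {φ : V → ℝ}
    (hφ : ∀ a b, G.Adj a b → |φ b - φ a| ≤ 1) (s : ℝ) (f : V → ℝ) :
    ∑ a, G.degree a *
        (walkAvg G (fun b => Real.exp (s * (φ b - walkAvg G φ a)) * f b) a) ^ 2 ≤
      Real.exp (16 * s ^ 2) * ∑ a, G.degree a * f a ^ 2 := by
  calc _ ≤ ∑ a, Real.exp (16 * s ^ 2) * ∑ b ∈ G.neighborFinset a, f b ^ 2 := by
        refine Finset.sum_le_sum fun a _ => ?_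
        rw [← degree_mul_walkAvg, mul_left_comm]
        refine mul_le_mul_of_nonneg_left ?_ (Nat.cast_nonneg _)
        refine (sq_walkAvg_mul_le _ _ _).trans ?_
        refine mul_le_mul_of_nonneg_right ?_ (walkAvg_nonneg fun b _ => sq_nonneg _)
        have := walkAvg_exp_centered_le (hdeg a) (hφ a) (2 * s)
        refine le_trans (le_of_eq (walkAvg_congr fun b _ => ?_)) (this.trans (le_of_eq ?_))
        · rw [← Real.exp_nat_mul]; congr 1; push_cast; ring
        · congr 1; ring
    _ = _ := by
        rw [← Finset.mul_sum, sum_neighborFinset_comm (G := G) (fun _ b => f b ^ 2)]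
        simp

/-- Here the weight is centred at the far end `b` of the edge. After Cauchy–Schwarz against the
constant one, swapping the ends of the edges makes `a` the random neighbour of `b`, and the
Hoeffding bound applies at `b`. -/
theorem sum_degree_mul_sq_tilt_left_le (hdeg : ∀ a, 0 < G.degree a) {φ : V → ℝ}
    (hφ : ∀ a b, G.Adj a b → |φ b - φ a| ≤ 1) (s : ℝ) (f : V → ℝ) :
    ∑ a, G.degree a *
        (walkAvg G (fun b => Real.exp (-s * (φ a - walkAvg G φ b)) * f b) a) ^ 2 ≤
      Real.exp (16 * s ^ 2) * ∑ a, G.degree a * f a ^ 2 := by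
  calc _ ≤ ∑ a, ∑ b ∈ G.neighborFinset a,
          Real.exp (-(2 * s) * (φ a - walkAvg G φ b)) * f b ^ 2 := by
        refine Finset.sum_le_sum fun a _ => ?_
        rw [← degree_mul_walkAvg]
        refine mul_le_mul_of_nonneg_left ?_ (Nat.cast_nonneg _)
        have := sq_walkAvg_mul_le (G := G) (fun _ => 1)
          (fun b => Real.exp (-s * (φ a - walkAvg G φ b)) * f b) a
        simp only [one_mul, one_pow, walkAvg_const (hdeg a)] at this
        refine this.trans (le_of_eq (walkAvg_congr fun b _ => ?_))
        rw [mul_pow, ← Real.exp_nat_mul]; congr 2; push_cast; ring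
    _ = ∑ b, G.degree b * walkAvg G
          (fun a => Real.exp (-(2 * s) * (φ a - walkAvg G φ b))) b * f b ^ 2 := by
        rw [sum_neighborFinset_comm]
        refine Finset.sum_congr rfl fun b _ => ?_
        rw [degree_mul_walkAvg, Finset.sum_mul]
    _ ≤ _ := by
        rw [Finset.mul_sum]
        refine Finset.sum_le_sum fun b _ => ?_
        have := walkAvg_exp_centered_le (hdeg b) (hφ b) (-(2 * s))
        have h4 : 4 * (-(2 * s)) ^ 2 = 16 * s ^ 2 := by ring
        rw [h4] at this
        calc _ = (G.degree b * f b ^ 2) * walkAvg G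
              (fun a => Real.exp (-(2 * s) * (φ a - walkAvg G φ b))) b := by ring
          _ ≤ (G.degree b * f b ^ 2) * Real.exp (16 * s ^ 2) := by gcongr
          _ = _ := by ring

/-- Two steps of the walk, conjugated with the exponential of a Lipschitz function, form an
almost contracting operator on `ℓ²(deg)`. -/
theorem sum_degree_mul_sq_conj_le (hdeg : ∀ a, 0 < G.degree a) {φ : V → ℝ}
    (hφ : ∀ a b, G.Adj a b → |φ b - φ a| ≤ 1) (s : ℝ) (f : V → ℝ) :
    ∑ a, G.degree a *
        (Real.exp (-s * φ a) *
          walkAvg G (walkAvg G fun b => Real.exp (s * φ b) * f b) a) ^ 2 ≤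
      Real.exp (32 * s ^ 2) * ∑ a, G.degree a * f a ^ 2 := by
  set g : V → ℝ := fun a => walkAvg G (fun b => Real.exp (s * (φ b - walkAvg G φ a)) * f b) a
  have h1 := sum_degree_mul_sq_tilt_right_le hdeg hφ s f
  have h2 := sum_degree_mul_sq_tilt_left_le hdeg hφ s g
  -- The increment of `φ` over two steps is split at the mean of `φ` around the middle vertex, so
  -- the drift there cancels.
  have h3 : ∀ a, walkAvg G (fun b => Real.exp (-s * (φ a - walkAvg G φ b)) * g b) a =
      Real.exp (-s * φ a) * walkAvg G (walkAvg G fun b => Real.exp (s * φ b) * f b) a := by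
    intro a
    rw [← walkAvg_const_mul]
    refine walkAvg_congr fun b _ => ?_
    simp only [g, ← walkAvg_const_mul]
    refine walkAvg_congr fun c _ => ?_
    rw [← mul_assoc, ← mul_assoc, ← Real.exp_add, ← Real.exp_add]
    congr 2; ring
  simp only [h3] at h2
  refine h2.trans ?_
  have h5 : Real.exp (32 * s ^ 2) = Real.exp (16 * s ^ 2) * Real.exp (16 * s ^ 2) := by
    rw [← Real.exp_add]; congr 1; ring
  rw [h5, mul_assoc]
  gcongr

/-- Between consecutive conjugated operators the exponential factors cancel, so the bounds multiply;
the function they start from is the constant one. -/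
theorem sum_degree_mul_sq_conj_iterate_le (hdeg : ∀ a, 0 < G.degree a) {φ : V → ℝ}
    (hφ : ∀ a b, G.Adj a b → |φ b - φ a| ≤ 1) (s : ℝ) (k : ℕ) :
    ∑ a, G.degree a * (Real.exp (-s * φ a) *
        (walkAvg G)^[2 * k] (fun b => Real.exp (s * φ b)) a) ^ 2 ≤
      Real.exp (32 * s ^ 2 * k) * ∑ a, (G.degree a : ℝ) := by
  induction k with
  | zero => simp [← Real.exp_add]
  | succ k ih =>
    have h := sum_degree_mul_sq_conj_le hdeg hφ s
      (fun a => Real.exp (-s * φ a) * (walkAvg G)^[2 * k] (fun b => Real.exp (s * φ b)) a)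
    have h1 : ∀ b, Real.exp (s * φ b) * (Real.exp (-s * φ b) *
        (walkAvg G)^[2 * k] (fun b => Real.exp (s * φ b)) b) =
        (walkAvg G)^[2 * k] (fun b => Real.exp (s * φ b)) b := by
      intro b
      rw [← mul_assoc, ← Real.exp_add]
      simp
    simp only [h1] at h
    have h2 : 2 * (k + 1) = (2 * k + 1) + 1 := by ring
    rw [h2]
    simp only [Function.iterate_succ_apply']
    refine h.trans ((mul_le_mul_of_nonneg_left ih (Real.exp_nonneg _)).trans (le_of_eq ?_))
    rw [← mul_assoc, ← Real.exp_add]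
    congr 2; push_cast; ring

/-- The value at `x` is one term of the weighted `ℓ²` sum, with weight at least one. The total
degree is at most `n ^ 2`; its square root is the factor `Fintype.card V`. -/
theorem walkAvg_iterate_exp_le (hdeg : ∀ a, 0 < G.degree a) {φ : V → ℝ}
    (hφ : ∀ a b, G.Adj a b → |φ b - φ a| ≤ 1) (s : ℝ) (k : ℕ) {x : V} (hx : φ x = 0) :
    (walkAvg G)^[2 * k] (fun b => Real.exp (s * φ b)) x ≤
      Real.exp (16 * s ^ 2 * k) * Fintype.card V := by
  refine (sq_le_sq₀ ?_ (by positivity)).1 ?_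
  · exact walkAvg_iterate_nonneg (fun b => (Real.exp_pos _).le) _ _
  set g := (walkAvg G)^[2 * k] (fun b => Real.exp (s * φ b)) with hg
  have hdx : (1 : ℝ) ≤ G.degree x := by exact_mod_cast hdeg x
  have h1 : G.degree x * (Real.exp (-s * φ x) * g x) ^ 2 ≤
      ∑ a, G.degree a * (Real.exp (-s * φ a) * g a) ^ 2 :=
    Finset.single_le_sum (f := fun a => G.degree a * (Real.exp (-s * φ a) * g a) ^ 2)
      (fun a _ => by positivity) (Finset.mem_univ x)
  have h2 : ∑ a, (G.degree a : ℝ) ≤ (Fintype.card V : ℝ) ^ 2 := by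
    calc _ ≤ ∑ _a : V, (Fintype.card V : ℝ) := by
          gcongr with a
          exact (G.degree_lt_card_verts a).le
      _ = _ := by simp [sq]
  have h3 := sum_degree_mul_sq_conj_iterate_le hdeg hφ s k
  rw [hx] at h1
  simp only [mul_zero, Real.exp_zero, one_mul] at h1
  calc g x ^ 2 ≤ G.degree x * g x ^ 2 := by nlinarith [sq_nonneg (g x)]
    _ ≤ Real.exp (32 * s ^ 2 * k) * (Fintype.card V : ℝ) ^ 2 :=
        (h1.trans h3).trans (by gcongr)
    _ = _ := by
        rw [mul_pow, ← Real.exp_nat_mul]; congr 2; push_cast; ring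

theorem walkAvg_iterate_dist_even_le (hG : G.Connected) (hdeg : ∀ a, 0 < G.degree a) {s : ℝ}
    (hs : 0 < s) (k : ℕ) (x : V) :
    (walkAvg G)^[2 * k] (fun b => (G.dist x b : ℝ)) x ≤
      (Real.log (Fintype.card V) + 1) / s + 16 * s * k := by
  have hn : (0 : ℝ) < Fintype.card V := by exact_mod_cast Fintype.card_pos_iff.2 ⟨x⟩
  -- `exp l` bounds the exponential moment, so scaling by `exp (-l)` brings it to at most one; the
  -- linear bound `h1` then replaces Jensen's inequality. Its `+ 0` fits the shape of
  -- `walkAvg_iterate_affine`.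
  set l := Real.log (Fintype.card V) + 16 * s ^ 2 * k with hl
  have h0 := walkAvg_iterate_exp_le hdeg (φ := fun b => (G.dist x b : ℝ))
    (fun a b h => abs_dist_sub_dist_le hG x h) s k (x := x) (by simp)
  have h1 : ∀ b, s * (G.dist x b : ℝ) + 0 ≤
      Real.exp (-l) * Real.exp (s * (G.dist x b : ℝ)) + l := by
    intro b
    rw [← Real.exp_add]
    linarith [Real.add_one_le_exp (-l + s * (G.dist x b : ℝ))]
  have h2 := walkAvg_iterate_mono (G := G) h1 (2 * k) x
  rw [walkAvg_iterate_affine hdeg, walkAvg_iterate_affine hdeg] at h2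
  have h3 : Real.exp (-l) * (Real.exp (16 * s ^ 2 * k) * Fintype.card V) = 1 := by
    conv_lhs => rw [← Real.exp_log hn]
    rw [← Real.exp_add, ← Real.exp_add, hl, Real.exp_eq_one_iff]
    ring
  have h4 := mul_le_mul_of_nonneg_left h0 (Real.exp_nonneg (-l))
  rw [h3] at h4
  have h5 : s * (walkAvg G)^[2 * k] (fun b => (G.dist x b : ℝ)) x ≤
      s * ((Real.log (Fintype.card V) + 1) / s + 16 * s * k) := by
    rw [mul_add, mul_div_cancel₀ _ hs.ne']
    linarith
  exact le_of_mul_le_mul_left h5 hs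

/-- The walk is diffusive: take `s` of order `t ^ (-1/2)`. -/
theorem walkAvg_iterate_dist_le (hG : G.Connected) (hdeg : ∀ a, 0 < G.degree a) {s : ℝ}
    (hs : 0 < s) (t : ℕ) (x : V) :
    (walkAvg G)^[t] (fun b => (G.dist x b : ℝ)) x ≤
      (Real.log (Fintype.card V) + 1) / s + 8 * s * t + 1 := by
  obtain ⟨k, rfl | rfl⟩ := t.even_or_odd'
  · have := walkAvg_iterate_dist_even_le hG hdeg hs k x
    push_cast
    linarith
  -- For odd `t` the extra step adds at most one to the distance.
  · have h1 := walkAvg_iterate_dist_even_le hG hdeg hs k x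
    have h2 : ∀ b, walkAvg G (fun b => (G.dist x b : ℝ)) b ≤ 1 * (G.dist x b : ℝ) + 1 := by
      intro b
      rw [← walkAvg_const (hdeg b) (1 * (G.dist x b : ℝ) + 1)]
      exact walkAvg_mono fun c hc => by linarith [(abs_le.1 (abs_dist_sub_dist_le hG x hc)).2]
    have h3 := walkAvg_iterate_mono (G := G) h2 (2 * k) x
    rw [walkAvg_iterate_affine hdeg] at h3
    rw [Function.iterate_succ_apply]
    push_cast
    have : 0 ≤ 8 * s := by positivity
    linarith

end WalkAverage

/-! ### Four steps end within distance three with probability of order `n ^ (-2/3)` -/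

theorem four_mul_le_of_pow_four_le {a b c d q : ℝ} (ha : 0 ≤ a) (hb : 0 ≤ b) (hc : 0 ≤ c)
    (hd : 0 ≤ d) (h : q ^ 4 ≤ a * b * (c * d)) : 4 * q ≤ a + b + (c + d) := by
  have h1 : a * b ≤ ((a + b) / 2) ^ 2 := by nlinarith [sq_nonneg (a - b)]
  have h2 : c * d ≤ ((c + d) / 2) ^ 2 := by nlinarith [sq_nonneg (c - d)]
  have h3 : (a + b) / 2 * ((c + d) / 2) ≤ ((a + b + (c + d)) / 4) ^ 2 := by
    nlinarith [sq_nonneg (a + b - (c + d))]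
  have h4 : q ^ 4 ≤ ((a + b + (c + d)) / 4) ^ 4 := by
    calc q ^ 4 ≤ ((a + b) / 2) ^ 2 * ((c + d) / 2) ^ 2 :=
          h.trans (mul_le_mul h1 h2 (by positivity) (by positivity))
      _ = ((a + b) / 2 * ((c + d) / 2)) ^ 2 := by ring
      _ ≤ (((a + b + (c + d)) / 4) ^ 2) ^ 2 := by gcongr
      _ = _ := by ring
  have h5 : q ≤ (a + b + (c + d)) / 4 := le_of_abs_le
    ((pow_le_pow_iff_left₀ (abs_nonneg q) (by positivity) (by norm_num : (4 : ℕ) ≠ 0)).1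
      (by rwa [Even.pow_abs (by decide)]))
  linarith

section Balls

variable {V : Type*} {G : SimpleGraph V}

theorem dist_le_succ_of_adj (hG : G.Connected) (x : V) {a b : V} (h : G.Adj a b) :
    G.dist x b ≤ G.dist x a + 1 := by
  have := hG.dist_triangle (u := x) (v := a) (w := b)
  rwa [SimpleGraph.dist_eq_one_iff_adj.2 h] at this

variable (G) in
/-- The indicator of the sphere of radius `i` around `x`. -/
noncomputable def sphereInd (x : V) (i : ℕ) (v : V) : ℝ := if G.dist x v = i then 1 else 0

variable (G) in
/-- The indicator of the ball of radius `i` around `x`. -/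
noncomputable def ballInd (x : V) (i : ℕ) (v : V) : ℝ := if G.dist x v ≤ i then 1 else 0

theorem sphereInd_nonneg (x : V) (i : ℕ) (v : V) : 0 ≤ sphereInd G x i v := by
  unfold sphereInd; split_ifs <;> norm_num

theorem ballInd_nonneg (x : V) (i : ℕ) (v : V) : 0 ≤ ballInd G x i v := by
  unfold ballInd; split_ifs <;> norm_num

theorem sphereInd_le_ballInd (x : V) {i j : ℕ} (h : i ≤ j) (v : V) :
    sphereInd G x i v ≤ ballInd G x j v := by
  unfold sphereInd ballInd
  split_ifs with h1 h2
  · exact le_rfl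
  · omega
  · exact zero_le_one
  · exact le_rfl

theorem ballInd_mono (x : V) {i j : ℕ} (h : i ≤ j) (v : V) : ballInd G x i v ≤ ballInd G x j v := by
  unfold ballInd
  split_ifs with h1 h2
  · exact le_rfl
  · omega
  · exact zero_le_one
  · exact le_rfl

end Balls

section Gain

variable {V : Type*} [Fintype V] {G : SimpleGraph V} [DecidableRel G.Adj]

theorem sum_mul_sum_neighborFinset (p h : V → ℝ) :
    ∑ u, p u * ∑ v ∈ G.neighborFinset u, h v = ∑ v, h v * (G.degree v * walkAvg G p v) := by
  simp only [degree_mul_walkAvg, Finset.mul_sum]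
  rw [sum_neighborFinset_comm (G := G) fun u v => p u * h v]
  simp only [mul_comm]

theorem walkAvg_sphereInd_pos {x : V} {i : ℕ} {u v : V} (h : G.Adj v u) (hu : G.dist x u = i) :
    0 < walkAvg G (sphereInd G x i) v := by
  have hv : 0 < G.degree v := (G.degree_pos_iff_exists_adj v).2 ⟨u, h⟩
  refine div_pos ?_ (by exact_mod_cast hv)
  exact Finset.sum_pos' (fun w _ => sphereInd_nonneg x i w)
    ⟨u, by simpa using h, by simp [sphereInd, hu]⟩

/-- Carries a near return at step two or three on to step four, at the price of one unit of radius
per step. -/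
theorem ballInd_le_walkAvg_ballInd (hG : G.Connected) (hdeg : ∀ a, 0 < G.degree a) (x : V)
    (i : ℕ) (v : V) : ballInd G x i v ≤ walkAvg G (ballInd G x (i + 1)) v := by
  unfold ballInd
  split_ifs with h
  · refine (walkAvg_const (hdeg v) 1).ge.trans (walkAvg_mono fun b hb => ?_)
    have := dist_le_succ_of_adj hG x hb
    rw [if_pos (by omega)]
  · exact walkAvg_nonneg fun b _ => by split_ifs <;> norm_num

theorem walkAvg_le_sum_sphereInd {x : V} {f : V → ℝ} (hf : ∀ v, 0 ≤ f v)
    (hx : 0 < G.degree x) : walkAvg G f x ≤ ∑ v, sphereInd G x 1 v * f v := by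
  have h1 : ∑ v, sphereInd G x 1 v * f v = ∑ v ∈ G.neighborFinset x, f v := by
    simp only [sphereInd, ite_mul, one_mul, zero_mul, SimpleGraph.dist_eq_one_iff_adj]
    rw [← Finset.sum_filter]
    congr 1
    ext v
    simp
  rw [h1]
  exact div_le_self (Finset.sum_nonneg fun v _ => hf v) (by exact_mod_cast hx)

/-- The reciprocal of the probability of the walk's path, averaged over the geodesic paths of
length three from `x` and weighted backwards, counts at most the sphere of radius three. -/
theorem walkAvg_geodesic_weight_le (hdeg : ∀ a, 0 < G.degree a) (x : V) :
    walkAvg G (fun a => G.degree a * walkAvg G (fun b => sphereInd G x 2 b *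
      (walkAvg G (sphereInd G x 1) b)⁻¹ * walkAvg G (fun c => sphereInd G x 3 c *
        (G.degree c * walkAvg G (sphereInd G x 2) c)⁻¹) b) a) x ≤ Fintype.card V := by
  set γ : V → ℝ := fun c => sphereInd G x 3 c * (G.degree c * walkAvg G (sphereInd G x 2) c)⁻¹
    with hγ
  set γ' : V → ℝ := fun b => sphereInd G x 2 b * (walkAvg G (sphereInd G x 1) b)⁻¹ *
    walkAvg G γ b with hγ'
  have hA : ∀ i b, 0 ≤ walkAvg G (sphereInd G x i) b := fun i b =>
    walkAvg_nonneg fun c _ => sphereInd_nonneg x i c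
  have hγ0 : ∀ c, 0 ≤ γ c := fun c => mul_nonneg (sphereInd_nonneg x 3 c)
    (inv_nonneg.2 (mul_nonneg (Nat.cast_nonneg _) (hA 2 c)))
  have hγ0' : ∀ c, 0 ≤ walkAvg G γ c := fun c => walkAvg_nonneg fun d _ => hγ0 d
  have hγ'0 : ∀ c, 0 ≤ γ' c := fun c => mul_nonneg (mul_nonneg (sphereInd_nonneg x 2 c)
    (inv_nonneg.2 (hA 1 c))) (hγ0' c)
  -- The sums are moved across the edges one level at a time. Each inverse weight cancels the number
  -- of predecessors in the previous sphere, so every vertex of the next sphere counts at most once.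
  calc _ ≤ ∑ a, sphereInd G x 1 a * (G.degree a * walkAvg G γ' a) :=
        walkAvg_le_sum_sphereInd (fun v => mul_nonneg (Nat.cast_nonneg _)
          (walkAvg_nonneg fun c _ => hγ'0 c)) (hdeg x)
    _ = ∑ b, γ' b * (G.degree b * walkAvg G (sphereInd G x 1) b) := by
        simp only [degree_mul_walkAvg γ', sum_mul_sum_neighborFinset]
    _ ≤ ∑ b, sphereInd G x 2 b * (G.degree b * walkAvg G γ b) := by
        refine Finset.sum_le_sum fun b _ => ?_
        have h1 : (walkAvg G (sphereInd G x 1) b)⁻¹ * walkAvg G (sphereInd G x 1) b ≤ 1 :=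
          inv_mul_le_one
        have h2 : 0 ≤ sphereInd G x 2 b * (G.degree b * walkAvg G γ b) :=
          mul_nonneg (sphereInd_nonneg x 2 b) (mul_nonneg (Nat.cast_nonneg _) (hγ0' b))
        calc _ = sphereInd G x 2 b * (G.degree b * walkAvg G γ b) *
              ((walkAvg G (sphereInd G x 1) b)⁻¹ * walkAvg G (sphereInd G x 1) b) := by
              rw [hγ']; ring
          _ ≤ _ := mul_le_of_le_one_right h2 h1
    _ = ∑ c, γ c * (G.degree c * walkAvg G (sphereInd G x 2) c) := by
        simp only [degree_mul_walkAvg γ, sum_mul_sum_neighborFinset]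
    _ ≤ ∑ _c : V, (1 : ℝ) := by
        refine Finset.sum_le_sum fun c _ => ?_
        have h1 : sphereInd G x 3 c ≤ 1 := by unfold sphereInd; split_ifs <;> norm_num
        rw [hγ, mul_assoc]
        exact mul_le_one₀ h1 (mul_nonneg (inv_nonneg.2 (mul_nonneg (Nat.cast_nonneg _) (hA 2 c)))
          (mul_nonneg (Nat.cast_nonneg _) (hA 2 c))) inv_mul_le_one
    _ = _ := by simp

/-- Averaging over the first three steps `a`, `b`, `c` of the walk from `x`. -/
theorem le_walkAvg_three (hdeg : ∀ a, 0 < G.degree a) {x : V} {θ θ' κ : ℝ}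
    {f₀ f₁ f₂ f₃ w₂ w₃ : V → ℝ}
    (h : ∀ a b c, G.Adj x a → G.Adj a b → G.Adj b c →
      θ ≤ θ' * f₀ c + f₁ a + f₂ b + f₃ c + κ * (G.degree a * (w₂ b * w₃ c))) :
    θ ≤ θ' * (walkAvg G)^[3] f₀ x + walkAvg G f₁ x + (walkAvg G)^[2] f₂ x +
      (walkAvg G)^[3] f₃ x +
      κ * walkAvg G (fun a => G.degree a * walkAvg G (fun b => w₂ b * walkAvg G w₃ b) a) x := by
  have h1 : ∀ a b, G.Adj x a → G.Adj a b →
      θ ≤ θ' * walkAvg G f₀ b + f₁ a + f₂ b + walkAvg G f₃ b +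
        κ * (G.degree a * (w₂ b * walkAvg G w₃ b)) := fun a b ha hb => by
    refine (walkAvg_const (hdeg b) θ).ge.trans
      ((walkAvg_mono fun c hc => h a b c ha hb hc).trans (le_of_eq ?_))
    simp only [walkAvg_add, walkAvg_const_mul, walkAvg_const (hdeg b)]
  have h2 : ∀ a, G.Adj x a →
      θ ≤ θ' * walkAvg G (walkAvg G f₀) a + f₁ a + walkAvg G f₂ a + walkAvg G (walkAvg G f₃) a +
        κ * (G.degree a * walkAvg G (fun b => w₂ b * walkAvg G w₃ b) a) := fun a ha => by
    refine (walkAvg_const (hdeg a) θ).ge.trans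
      ((walkAvg_mono fun b hb => h1 a b ha hb).trans (le_of_eq ?_))
    simp only [walkAvg_add, walkAvg_const_mul, walkAvg_const (hdeg a)]
  refine (walkAvg_const (hdeg x) θ).ge.trans
    ((walkAvg_mono fun a ha => h2 a ha).trans (le_of_eq ?_))
  simp only [walkAvg_add, walkAvg_const_mul, Function.iterate_succ_apply', Function.iterate_zero,
    id_eq]

/-- If `c` is within two of `x`, the first term alone is `4 * q`. Otherwise the path is geodesic and
AM–GM applies to the other four terms: the last is designed so that their product collapses to `q /
(n * deg c)`, which is at least `q / n ^ 2 = q ^ 4`. -/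
theorem gain_pointwise (hG : G.Connected) {q : ℝ} (hq : 0 < q)
    (hqn : q ^ 3 * (Fintype.card V : ℝ) ^ 2 = 1) {x a b c : V} (ha : G.Adj x a) (hb : G.Adj a b)
    (hc : G.Adj b c) :
    4 * q ≤ 4 * q * ballInd G x 2 c + (G.degree a : ℝ)⁻¹ +
      sphereInd G x 2 b * walkAvg G (sphereInd G x 1) b +
      sphereInd G x 3 c * walkAvg G (sphereInd G x 2) c +
      q / Fintype.card V * (G.degree a * (sphereInd G x 2 b *
        (walkAvg G (sphereInd G x 1) b)⁻¹ * (sphereInd G x 3 c *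
          (G.degree c * walkAvg G (sphereInd G x 2) c)⁻¹))) := by
  have hA : ∀ i b, 0 ≤ walkAvg G (sphereInd G x i) b := fun i b =>
    walkAvg_nonneg fun c _ => sphereInd_nonneg x i c
  have hn : (0 : ℝ) < Fintype.card V := by exact_mod_cast Fintype.card_pos_iff.2 ⟨x⟩
  have hxa : G.dist x a = 1 := SimpleGraph.dist_eq_one_iff_adj.2 ha
  have hxb := dist_le_succ_of_adj hG x hb
  have hxc := dist_le_succ_of_adj hG x hc
  have h2b := sphereInd_nonneg (G := G) x 2 b
  have h3c := sphereInd_nonneg (G := G) x 3 c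
  have p1 := hA 1 b
  have p2 := hA 2 c
  by_cases h : G.dist x c ≤ 2
  · have : ballInd G x 2 c = 1 := if_pos h
    rw [this]
    have : 0 ≤ (G.degree a : ℝ)⁻¹ + sphereInd G x 2 b * walkAvg G (sphereInd G x 1) b +
      sphereInd G x 3 c * walkAvg G (sphereInd G x 2) c +
      q / Fintype.card V * (G.degree a * (sphereInd G x 2 b *
        (walkAvg G (sphereInd G x 1) b)⁻¹ * (sphereInd G x 3 c *
          (G.degree c * walkAvg G (sphereInd G x 2) c)⁻¹))) := by positivity
    linarith
  · have hb2 : G.dist x b = 2 := by omega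
    have hc3 : G.dist x c = 3 := by omega
    have e1 : ballInd G x 2 c = 0 := if_neg h
    have e2 : sphereInd G x 2 b = 1 := if_pos hb2
    have e3 : sphereInd G x 3 c = 1 := if_pos hc3
    have h1 : 0 < walkAvg G (sphereInd G x 1) b := walkAvg_sphereInd_pos hb.symm hxa
    have h2 : 0 < walkAvg G (sphereInd G x 2) c := walkAvg_sphereInd_pos hc.symm hb2
    have hda : (0 : ℝ) < G.degree a := by
      exact_mod_cast (G.degree_pos_iff_exists_adj a).2 ⟨b, hb⟩
    have hdc : (0 : ℝ) < G.degree c := by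
      exact_mod_cast (G.degree_pos_iff_exists_adj c).2 ⟨b, hc.symm⟩
    have hdn : (G.degree c : ℝ) ≤ Fintype.card V := by
      exact_mod_cast (G.degree_lt_card_verts c).le
    simp only [e1, e2, e3, mul_zero, one_mul, zero_add]
    have key := four_mul_le_of_pow_four_le (q := q) (inv_nonneg.2 hda.le) p1 p2
      (d := q / Fintype.card V * (G.degree a * ((walkAvg G (sphereInd G x 1) b)⁻¹ *
        (G.degree c * walkAvg G (sphereInd G x 2) c)⁻¹))) (by positivity) ?_
    · linarith
    · have : (G.degree a : ℝ)⁻¹ * walkAvg G (sphereInd G x 1) b *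
          (walkAvg G (sphereInd G x 2) c *
          (q / Fintype.card V * (G.degree a * ((walkAvg G (sphereInd G x 1) b)⁻¹ *
        (G.degree c * walkAvg G (sphereInd G x 2) c)⁻¹)))) =
          q / (Fintype.card V * G.degree c) := by
        field_simp
      rw [this, le_div_iff₀ (by positivity)]
      calc q ^ 4 * (Fintype.card V * G.degree c)
          ≤ q ^ 4 * (Fintype.card V * Fintype.card V) := by gcongr
        _ = q * (q ^ 3 * (Fintype.card V : ℝ) ^ 2) := by ring
        _ = q := by rw [hqn, mul_one]

/-- After four steps the walk is, with probability of order at least `n ^ (-2/3)`, within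
distance three of its start. -/
theorem walkAvg_iterate_four_ballInd_ge (hG : G.Connected) (hdeg : ∀ a, 0 < G.degree a) {q : ℝ}
    (hq : 0 < q) (hqn : q ^ 3 * (Fintype.card V : ℝ) ^ 2 = 1) (x : V) :
    3 / 7 * q ≤ (walkAvg G)^[4] (ballInd G x 3) x := by
  have hn : (1 : ℝ) ≤ Fintype.card V := by exact_mod_cast Fintype.card_pos_iff.2 ⟨x⟩
  have hq1 : q ≤ 1 := by
    by_contra! h
    nlinarith [one_lt_pow₀ h (by norm_num : (3 : ℕ) ≠ 0), one_le_pow₀ hn (n := 2)]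
  set ε := (walkAvg G)^[4] (ballInd G x 3) x with hε
  have hball : ∀ i, ∀ v, ballInd G x i v ≤ walkAvg G (ballInd G x (i + 1)) v := fun i v =>
    ballInd_le_walkAvg_ballInd hG hdeg x i v
  have e3 : (walkAvg G)^[3] (ballInd G x 2) x ≤ ε := walkAvg_iterate_mono (hball 2) 3 x
  have e2 : (walkAvg G)^[2] (ballInd G x 1) x ≤ ε :=
    (walkAvg_iterate_mono (hball 1) 2 x).trans e3
  -- From `a` the walk returns to `x` itself with probability `1 / deg a`.
  have t1 : walkAvg G (fun a => (G.degree a : ℝ)⁻¹) x ≤ ε := by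
    refine le_trans (walkAvg_mono fun a ha => ?_) e2
    have h1 : (1 : ℝ) ≤ ∑ b ∈ G.neighborFinset a, ballInd G x 1 b := by
      have hx : ballInd G x 1 x = 1 := by simp [ballInd]
      rw [← hx]
      exact Finset.single_le_sum (f := ballInd G x 1) (fun b _ => ballInd_nonneg x 1 b)
        (by simpa using ha.symm)
    rw [inv_eq_one_div]
    exact div_le_div_of_nonneg_right h1 (Nat.cast_nonneg _)
  have s1 : ∀ i v, sphereInd G x (i + 1) v * walkAvg G (sphereInd G x i) v ≤
      walkAvg G (ballInd G x i) v := fun i v => by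
    have h1 : sphereInd G x (i + 1) v ≤ 1 := by unfold sphereInd; split_ifs <;> norm_num
    refine (mul_le_of_le_one_left (walkAvg_nonneg fun b _ => sphereInd_nonneg x i b) h1).trans ?_
    exact walkAvg_mono fun b _ => sphereInd_le_ballInd x le_rfl b
  have t2 : (walkAvg G)^[2] (fun b => sphereInd G x 2 b * walkAvg G (sphereInd G x 1) b) x ≤ ε := by
    refine le_trans (walkAvg_iterate_mono (fun b => (s1 1 b).trans ?_) 2 x) e3
    exact walkAvg_mono fun b _ => ballInd_mono x (by norm_num) b
  have t3 : (walkAvg G)^[3] (fun b => sphereInd G x 3 b * walkAvg G (sphereInd G x 2) b) x ≤ ε := by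
    refine walkAvg_iterate_mono (fun b => (s1 2 b).trans ?_) 3 x
    exact walkAvg_mono fun b _ => ballInd_mono x (by norm_num) b
  have t4 := walkAvg_geodesic_weight_le hdeg x
  have key : 4 * q ≤ 4 * q * (walkAvg G)^[3] (ballInd G x 2) x +
      walkAvg G (fun a => (G.degree a : ℝ)⁻¹) x +
      (walkAvg G)^[2] (fun b => sphereInd G x 2 b * walkAvg G (sphereInd G x 1) b) x +
      (walkAvg G)^[3] (fun b => sphereInd G x 3 b * walkAvg G (sphereInd G x 2) b) x +
      q / Fintype.card V * walkAvg G (fun a => G.degree a * walkAvg G (fun b =>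
        sphereInd G x 2 b * (walkAvg G (sphereInd G x 1) b)⁻¹ * walkAvg G (fun c =>
        sphereInd G x 3 c * (G.degree c * walkAvg G (sphereInd G x 2) c)⁻¹) b) a) x := by
    refine le_walkAvg_three hdeg fun a b c ha hb hc => ?_
    exact gain_pointwise hG hq hqn ha hb hc
  have t4' : q / Fintype.card V * walkAvg G (fun a => G.degree a * walkAvg G (fun b =>
        sphereInd G x 2 b * (walkAvg G (sphereInd G x 1) b)⁻¹ * walkAvg G (fun c =>
        sphereInd G x 3 c * (G.degree c * walkAvg G (sphereInd G x 2) c)⁻¹) b) a) x ≤ q := by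
    refine (mul_le_mul_of_nonneg_left t4 (by positivity)).trans (le_of_eq ?_)
    field_simp
  have t0 : 4 * q * (walkAvg G)^[3] (ballInd G x 2) x ≤ 4 * ε := by
    have h0 : 0 ≤ (walkAvg G)^[3] (ballInd G x 2) x :=
      walkAvg_iterate_nonneg (ballInd_nonneg x 2) 3 x
    nlinarith
  -- The bounds add up to `4q ≤ 4ε + 3ε + q`, whence the constant `3 / 7`.
  linarith

end Gain

/-! ### Diameter against maximum degree -/

theorem exists_dist_eq_of_le_diam {V : Type*} [Finite V] {G : SimpleGraph V} (hG : G.Connected) :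
    ∃ u : V, ∀ j ≤ G.diam, ∃ v, G.dist u v = j := by
  have := hG.nonempty
  obtain ⟨u, w, huw⟩ := G.exists_dist_eq_diam
  obtain ⟨p, hp⟩ := hG.exists_walk_length_eq_dist u w
  refine ⟨u, fun j hj => ⟨p.getVert j, ?_⟩⟩
  have h1 : G.dist u (p.getVert j) ≤ j :=
    (SimpleGraph.dist_le (p.take j)).trans (by simp)
  have h2 : G.dist (p.getVert j) w ≤ p.length - j :=
    (SimpleGraph.dist_le (p.drop j)).trans (by simp)
  have h3 := hG.dist_triangle (u := u) (v := p.getVert j) (w := w)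
  omega

/-- The neighbours of a vertex of maximum degree occupy at most three consecutive levels of the
distance from the end `u` of a diametral geodesic. Each of the remaining levels, at least `diam - 2`
of them, contains a non-neighbour. -/
theorem diam_add_maxDegree_le {V : Type*} [Fintype V] {G : SimpleGraph V} [DecidableRel G.Adj]
    (hG : G.Connected) : G.diam + G.maxDegree ≤ Fintype.card V + 2 := by
  classical
  have := hG.nonempty
  obtain ⟨u, hu⟩ := exists_dist_eq_of_le_diam hG
  obtain ⟨w, hw⟩ := G.exists_maximal_degree_vertex
  set k := G.dist u w
  have h1 : Finset.range (G.diam + 1) \ {k - 1, k, k + 1} ⊆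
      (Finset.univ \ G.neighborFinset w).image (G.dist u) := by
    intro j hj
    simp only [Finset.mem_sdiff, Finset.mem_range, Finset.mem_insert, Finset.mem_singleton,
      not_or] at hj
    obtain ⟨v, hv⟩ := hu j (by omega)
    refine Finset.mem_image.2 ⟨v, ?_, hv⟩
    simp only [Finset.mem_sdiff, Finset.mem_univ, true_and, SimpleGraph.mem_neighborFinset]
    intro hwv
    have h2 := dist_le_succ_of_adj hG u hwv
    have h3 := dist_le_succ_of_adj hG u hwv.symm
    omega
  have h2 := (Finset.card_le_card h1).trans Finset.card_image_le
  have h3 := Finset.le_card_sdiff {k - 1, k, k + 1} (Finset.range (G.diam + 1))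
  have h4 : ({k - 1, k, k + 1} : Finset ℕ).card ≤ 3 := Finset.card_le_three
  rw [Finset.card_sdiff_of_subset (Finset.subset_univ _), Finset.card_univ,
    SimpleGraph.card_neighborFinset_eq_degree, ← hw] at h2
  rw [Finset.card_range] at h3
  have h5 : G.maxDegree < Fintype.card V := by rw [hw]; exact G.degree_lt_card_verts w
  omega

/-! ### Functions of the past and the Markov property -/

/-- `F` is determined by the robber's first `t` moves and the cop's first `t + 1` moves. -/
def DeterminedAt {V Ω β : Type*} (X Y : ℕ → Ω → V) (t : ℕ) (F : Ω → β) : Prop :=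
  ∀ ω ω', (∀ s ≤ t, X s ω = X s ω') → (∀ s ≤ t + 1, Y s ω = Y s ω') → F ω = F ω'

namespace DeterminedAt

variable {V Ω β γ δ : Type*} {X Y : ℕ → Ω → V} {t : ℕ}

theorem mono {F : Ω → β} (h : DeterminedAt X Y t F) {t' : ℕ} (ht : t ≤ t') :
    DeterminedAt X Y t' F := fun ω ω' hX hY =>
  h ω ω' (fun s hs => hX s (hs.trans ht)) fun s hs => hY s (by omega)

theorem comp {F : Ω → β} (h : DeterminedAt X Y t F) (g : β → γ) :
    DeterminedAt X Y t fun ω => g (F ω) := fun ω ω' hX hY => congrArg g (h ω ω' hX hY)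

theorem comp₂ {F : Ω → β} {F' : Ω → γ} (h : DeterminedAt X Y t F) (h' : DeterminedAt X Y t F')
    (g : β → γ → δ) : DeterminedAt X Y t fun ω => g (F ω) (F' ω) := fun ω ω' hX hY => by
  simp only [h ω ω' hX hY, h' ω ω' hX hY]

end DeterminedAt

theorem determinedAt_robber {V Ω : Type*} {X Y : ℕ → Ω → V} {s t : ℕ} (h : s ≤ t) :
    DeterminedAt X Y t (X s) := fun _ _ hX _ => hX s h

/-- The positions that make up `history`, as a map to a finite type. -/
def historyMap {V Ω : Type*} (X Y : ℕ → Ω → V) (t : ℕ) (ω : Ω) :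
    (Fin (t + 1) → V) × (Fin (t + 2) → V) :=
  (fun i => X i ω, fun i => Y i ω)

theorem historyMap_eq_iff {V Ω : Type*} {X Y : ℕ → Ω → V} {t : ℕ} {ω ω' : Ω} :
    historyMap X Y t ω = historyMap X Y t ω' ↔
      ω ∈ history X Y t (fun s => X s ω') (fun s => Y s ω') := by
  simp only [historyMap, Prod.mk.injEq, funext_iff, Fin.forall_iff, history, Set.mem_ofPred_eq,
    Nat.lt_succ_iff]

/-- The history map has finite range and its fibres are the events `history`; through this
factorisation, functions of the past are measurable and integrate to finite sums. -/
theorem DeterminedAt.exists_eq_comp {V Ω β : Type*} [Nonempty β] {X Y : ℕ → Ω → V} {t : ℕ}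
    {F : Ω → β} (h : DeterminedAt X Y t F) : ∃ g, F = g ∘ historyMap X Y t := by
  refine (Function.factorsThrough_iff F).1 fun ω ω' hω => ?_
  have := historyMap_eq_iff.1 hω
  exact h ω ω' this.1 this.2

theorem sum_stepProb_mul_ofReal {V : Type*} [Fintype V] {G : SimpleGraph V} [DecidableRel G.Adj]
    {f : V → ℝ} (hf : ∀ b, 0 ≤ f b) {a : V} (ha : 0 < G.degree a) :
    ∑ b, stepProb G a b * ENNReal.ofReal (f b) = ENNReal.ofReal (walkAvg G f a) := by
  have ha' : (0 : ℝ) < G.degree a := by exact_mod_cast ha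
  simp only [stepProb, ite_mul, zero_mul]
  rw [← Finset.sum_filter, ← Finset.mul_sum, ← ENNReal.ofReal_sum_of_nonneg fun b _ => hf b]
  have h1 : Finset.univ.filter (G.Adj a) = G.neighborFinset a := by ext; simp
  rw [h1, walkAvg, ENNReal.ofReal_div_of_pos ha', ENNReal.div_eq_inv_mul, ENNReal.ofReal_natCast]

namespace IsDrunkGame

variable {V Ω : Type*} [Fintype V] {G : SimpleGraph V} [DecidableRel G.Adj] [MeasurableSpace Ω]
  {P : Measure Ω} {X Y : ℕ → Ω → V} {r c : V}

theorem measurable_historyMap (h : IsDrunkGame G P X Y r c) (t : ℕ) :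
    @Measurable _ _ _ ⊤ (historyMap X Y t) := by
  refine @measurable_to_countable' _ _ ⊤ _ _ _ fun a => ?_
  have : historyMap X Y t ⁻¹' {a} =
      (⋂ i : Fin (t + 1), {ω | X i ω = a.1 i}) ∩
        ⋂ i : Fin (t + 2), {ω | Y i ω = a.2 i} := by
    ext ω
    simp [historyMap, Prod.ext_iff, funext_iff]
  rw [this]
  exact (MeasurableSet.iInter fun i => h.measurable_robber _ _).inter
    (MeasurableSet.iInter fun i => h.measurable_cop _ _)

theorem measurable_of_determinedAt (h : IsDrunkGame G P X Y r c) {t : ℕ} {β : Type*}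
    [MeasurableSpace β] [Nonempty β] {F : Ω → β} (hF : DeterminedAt X Y t F) : Measurable F := by
  obtain ⟨g, rfl⟩ := hF.exists_eq_comp
  exact (@measurable_from_top _ _ _ g).comp (h.measurable_historyMap t)

theorem measurableSet_of_determinedAt (h : IsDrunkGame G P X Y r c) {t : ℕ} {A : Ω → Prop}
    (hA : DeterminedAt X Y t A) : MeasurableSet {ω | A ω} :=
  measurableSet_setOfPred.2 (h.measurable_of_determinedAt hA)

/-- On each nonempty fibre of the history map `F` is constant, and `robber_step` applies to the
fibre. -/
theorem setLIntegral_robber_step (h : IsDrunkGame G P X Y r c) {t : ℕ} {F : Ω → ℝ≥0∞}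
    (hF : DeterminedAt X Y t F) (b : V) :
    ∫⁻ ω in {ω | X (t + 1) ω = b}, F ω ∂P = ∫⁻ ω, stepProb G (X t ω) b * F ω ∂P := by
  let _ : MeasurableSpace ((Fin (t + 1) → V) × (Fin (t + 2) → V)) := ⊤
  have : DiscreteMeasurableSpace ((Fin (t + 1) → V) × (Fin (t + 2) → V)) := ⟨fun _ => trivial⟩
  have hm : Measurable (historyMap X Y t) := h.measurable_historyMap t
  have hF' : DeterminedAt X Y t fun ω => stepProb G (X t ω) b * F ω :=
    (determinedAt_robber le_rfl).comp₂ hF fun a z => stepProb G a b * z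
  obtain ⟨g, rfl⟩ := hF.exists_eq_comp
  obtain ⟨g', hg'⟩ := hF'.exists_eq_comp
  have e : ∀ (μ : Measure Ω) (f : (Fin (t + 1) → V) × (Fin (t + 2) → V) → ℝ≥0∞),
      ∫⁻ ω, (f ∘ historyMap X Y t) ω ∂μ = ∑ a, f a * μ (historyMap X Y t ⁻¹' {a}) := by
    intro μ f
    simp only [Function.comp_apply]
    rw [← lintegral_map (f := f) measurable_from_top hm, lintegral_fintype]
    refine Finset.sum_congr rfl fun a _ => ?_
    rw [Measure.map_apply hm (MeasurableSet.of_discrete)]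
  rw [hg', e, e]
  refine Finset.sum_congr rfl fun a _ => ?_
  rw [Measure.restrict_apply (hm MeasurableSet.of_discrete)]
  rcases (historyMap X Y t ⁻¹' {a}).eq_empty_or_nonempty with h0 | ⟨ω, rfl⟩
  · simp [h0]
  · have h1 : historyMap X Y t ⁻¹' {historyMap X Y t ω} =
        history X Y t (fun s => X s ω) (fun s => Y s ω) := by
      ext ω'
      simp only [Set.mem_preimage, Set.mem_singleton_iff, historyMap_eq_iff]
    have h2 := congrFun hg' ω
    simp only [Function.comp_apply] at h2
    rw [h1, h.robber_step, ← h2]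
    ring

theorem lintegral_robber_step (h : IsDrunkGame G P X Y r c) {t : ℕ} {F : Ω → V → ℝ≥0∞}
    (hF : DeterminedAt X Y t F) :
    ∫⁻ ω, F ω (X (t + 1) ω) ∂P = ∫⁻ ω, ∑ b, stepProb G (X t ω) b * F ω b ∂P := by
  classical
  have hFb : ∀ b, DeterminedAt X Y t fun ω => F ω b := fun b => hF.comp fun f => f b
  have h1 : ∀ ω, F ω (X (t + 1) ω) =
      ∑ b, Set.indicator {ω | X (t + 1) ω = b} (fun ω => F ω b) ω := by
    intro ω
    simp [Set.indicator_apply]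
  simp only [h1]
  rw [lintegral_finsetSum _ fun b _ =>
      (h.measurable_of_determinedAt (hFb b)).indicator (h.measurable_robber _ _),
    lintegral_finsetSum _ fun b _ => h.measurable_of_determinedAt
      ((determinedAt_robber le_rfl).comp₂ (hFb b) fun a z => stepProb G a b * z)]
  refine Finset.sum_congr rfl fun b _ => ?_
  rw [lintegral_indicator (h.measurable_robber _ _), h.setLIntegral_robber_step (hFb b)]

theorem ae_adj (h : IsDrunkGame G P X Y r c) : ∀ᵐ ω ∂P, ∀ t, G.Adj (X t ω) (X (t + 1) ω) := by
  classical
  rw [ae_all_iff]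
  intro t
  have h1 := h.lintegral_robber_step (t := t)
    (F := fun ω b => if G.Adj (X t ω) b then 0 else 1)
    ((determinedAt_robber le_rfl).comp fun a b => if G.Adj a b then (0 : ℝ≥0∞) else 1)
  have h2 : ∀ ω, ∑ b, stepProb G (X t ω) b * (if G.Adj (X t ω) b then 0 else 1) = 0 := fun ω =>
    Finset.sum_eq_zero fun b _ => by unfold stepProb; split_ifs <;> simp
  simp only [h2, lintegral_zero] at h1
  have h3 : Measurable fun ω => if G.Adj (X t ω) (X (t + 1) ω) then (0 : ℝ≥0∞) else 1 :=
    h.measurable_of_determinedAt (t := t + 1)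
      ((determinedAt_robber (by omega)).comp₂ (determinedAt_robber le_rfl)
        fun a b => if G.Adj a b then (0 : ℝ≥0∞) else 1)
  filter_upwards [(lintegral_eq_zero_iff h3).1 h1] with ω hω
  by_contra h4
  simp [h4] at hω

/-- The Markov property, for `k` steps. -/
theorem lintegral_robber_steps (h : IsDrunkGame G P X Y r c) (hdeg : ∀ a, 0 < G.degree a) {t : ℕ}
    (k : ℕ) {F : Ω → V → ℝ} (hF : DeterminedAt X Y t F) (h0 : ∀ ω b, 0 ≤ F ω b) :
    ∫⁻ ω, ENNReal.ofReal (F ω (X (t + k) ω)) ∂P =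
      ∫⁻ ω, ENNReal.ofReal ((walkAvg G)^[k] (F ω) (X t ω)) ∂P := by
  induction k generalizing F with
  | zero => rfl
  | succ k ih =>
    have h1 := h.lintegral_robber_step (t := t + k) (F := fun ω b => ENNReal.ofReal (F ω b))
      ((hF.mono (by omega)).comp fun f b => ENNReal.ofReal (f b))
    rw [← add_assoc, h1]
    simp only [sum_stepProb_mul_ofReal (h0 _) (hdeg _)]
    exact ih (F := fun ω => walkAvg G (F ω)) (hF.comp (walkAvg G))
      fun ω b => walkAvg_nonneg fun _ _ => h0 ω _

theorem setLIntegral_robber_steps (h : IsDrunkGame G P X Y r c) (hdeg : ∀ a, 0 < G.degree a)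
    {t : ℕ} (k : ℕ) {A : Ω → Prop} (hA : DeterminedAt X Y t A) {F : Ω → V → ℝ}
    (hF : DeterminedAt X Y t F) (h0 : ∀ ω b, 0 ≤ F ω b) :
    ∫⁻ ω in {ω | A ω}, ENNReal.ofReal (F ω (X (t + k) ω)) ∂P =
      ∫⁻ ω in {ω | A ω}, ENNReal.ofReal ((walkAvg G)^[k] (F ω) (X t ω)) ∂P := by
  classical
  have hz : ∀ a, (walkAvg G)^[k] (fun _ => 0) a = 0 := fun a => by
    have := walkAvg_iterate_affine hdeg 0 0 (fun _ => 0) k a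
    simpa using this
  have h1 := h.lintegral_robber_steps hdeg k (F := fun ω => if A ω then F ω else fun _ => 0)
    (hA.comp₂ hF fun p f => if p then f else fun _ => 0)
    (fun ω b => by split_ifs; exacts [h0 ω b, le_rfl])
  rw [← lintegral_indicator (h.measurableSet_of_determinedAt hA),
    ← lintegral_indicator (h.measurableSet_of_determinedAt hA)]
  convert h1 using 3 with ω ω
  · by_cases hω : A ω <;> simp [hω]
  · by_cases hω : A ω <;> simp [hω, hz]

end IsDrunkGame

/-! ### Accounting along a single play -/

section Plays

variable {V : Type*} {G : SimpleGraph V} {x y : ℕ → V}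

theorem FreeAt.mono {s t : ℕ} (h : FreeAt x y t) (hs : s ≤ t) : FreeAt x y s :=
  fun u hu => h u (hu.trans hs)

theorem FreeAt.ne {t : ℕ} (h : FreeAt x y t) : x t ≠ y t := fun e => h t le_rfl (Or.inl e)

theorem FreeAt.ne_of_succ {t : ℕ} (h : FreeAt x y (t + 1)) : y (t + 1) ≠ x t :=
  fun e => h (t + 1) le_rfl (Or.inr ⟨t, rfl, e⟩)

open scoped Classical in
theorem captureTime_le_tsum (x y : ℕ → V) :
    ((captureTime x y : ℕ∞) : ℝ≥0∞) ≤ ∑' t, if FreeAt x y t then 1 else 0 := by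
  by_cases h : ∃ t, CaughtAt x y t
  · have hfree : ∀ t < Nat.find h, FreeAt x y t := fun t ht s hs =>
      Nat.find_min h (hs.trans_lt ht)
    have h1 : captureTime x y ≤ (Nat.find h : ℕ∞) := iInf₂_le _ (Nat.find_spec h)
    calc ((captureTime x y : ℕ∞) : ℝ≥0∞) ≤ ((Nat.find h : ℕ∞) : ℝ≥0∞) := by exact_mod_cast h1
      _ = ∑ t ∈ Finset.range (Nat.find h), if FreeAt x y t then 1 else 0 := by
          rw [Finset.sum_congr rfl fun t ht => if_pos (hfree t (Finset.mem_range.1 ht))]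
          simp
      _ ≤ _ := ENNReal.sum_le_tsum _
  · push Not at h
    have h1 : ∀ t, FreeAt x y t := fun t s _ => h s
    simp [h1]

theorem dist_add_eq_of_stepsToward {w : V} {a m : ℕ}
    (h : ∀ t, a ≤ t → t < a + m → StepsToward G (y t) (y (t + 1)) w) :
    G.dist (y (a + m)) w + m = G.dist (y a) w := by
  induction m with
  | zero => rfl
  | succ m ih =>
    have h1 := (h (a + m) (by omega) (by omega)).2
    have h2 := ih fun t h3 h4 => h t h3 (by omega)
    rw [← add_assoc a m 1]
    omega

theorem exists_adj_dist_add_one_eq (hG : G.Connected) {a w : V} (h : a ≠ w) :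
    ∃ b, G.Adj a b ∧ G.dist b w + 1 = G.dist a w := by
  obtain ⟨p, hp⟩ := hG.exists_walk_length_eq_dist a w
  cases p with
  | nil => exact absurd rfl h
  | @cons _ b _ hab q =>
    refine ⟨b, hab, ?_⟩
    rw [SimpleGraph.Walk.length_cons] at hp
    have h1 := SimpleGraph.dist_le q
    have h2 := hG.dist_triangle (u := a) (v := b) (w := w)
    rw [SimpleGraph.dist_eq_one_iff_adj.2 hab] at h2
    omega

theorem GreedyStep.dist_add_one_le (hG : G.Connected) {a b w : V} (h : GreedyStep G a b w)
    (hw : a ≠ w) : G.dist b w + 1 ≤ G.dist a w := by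
  obtain ⟨c, hc, hcw⟩ := exists_adj_dist_add_one_eq hG hw
  have := h.2 c hc
  omega

theorem stage1End_le_stage2End : stage1End G x y ≤ stage2End G x y := Nat.le_add_right _ _

theorem FollowsFourStages.cop_stage1End (hG : G.Connected) (h : FollowsFourStages G x y)
    (hf : FreeAt x y (stage1End G x y)) : y (stage1End G x y) = x 0 := by
  have h1 := dist_add_eq_of_stepsToward (a := 0) (m := stage1End G x y) fun t _ ht =>
    h.stage1 t (hf.mono (by omega)) (by omega)
  rw [zero_add] at h1
  unfold stage1End at h1 ⊢
  exact (hG.dist_eq_zero_iff).1 (by omega)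

theorem FollowsFourStages.cop_stage2End (hG : G.Connected) (h : FollowsFourStages G x y)
    (hf : FreeAt x y (stage2End G x y)) : y (stage2End G x y) = x (stage1End G x y) := by
  have h1 := dist_add_eq_of_stepsToward (a := stage1End G x y)
    (m := G.dist (y (stage1End G x y)) (x (stage1End G x y))) fun t h0 ht =>
      h.stage2 t (hf.mono ht.le) h0 ht
  exact (hG.dist_eq_zero_iff).1 (by unfold stage2End; omega)

theorem FollowsFourStages.stage2End_eq (hG : G.Connected) (h : FollowsFourStages G x y)
    (hf : FreeAt x y (stage1End G x y)) :
    stage2End G x y = stage1End G x y + G.dist (x 0) (x (stage1End G x y)) := by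
  unfold stage2End
  rw [h.cop_stage1End hG hf]

theorem StillRetargeting.mono {s t : ℕ} (h : StillRetargeting G x y t) (hs : s ≤ t) :
    StillRetargeting G x y s := fun i hi => h i (hi.trans hs)

/-- The robber is free after `t` moves and the cop is about to choose a new target in Stage 3. -/
def RetargetsAt (G : SimpleGraph V) (x y : ℕ → V) (t : ℕ) : Prop :=
  FreeAt x y t ∧ stage2End G x y ≤ t ∧ 4 ∣ t - stage2End G x y ∧ StillRetargeting G x y t

/-- Stage 4 has begun when it is the cop's turn after `t` moves. -/
def InStageFour (G : SimpleGraph V) (x y : ℕ → V) (t : ℕ) : Prop :=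
  stage2End G x y ≤ t ∧ ¬ StillRetargeting G x y t

/-- The cop's move `t + 1` is in Stage 4 and does not catch the robber. -/
def SurvivesGreedyAt (G : SimpleGraph V) (x y : ℕ → V) (t : ℕ) : Prop :=
  FreeAt x y t ∧ InStageFour G x y t ∧ y (t + 1) ≠ x t

theorem InStageFour.mono {s t : ℕ} (h : InStageFour G x y s) (hs : s ≤ t) : InStageFour G x y t :=
  ⟨h.1.trans hs, fun h1 => h.2 (h1.mono hs)⟩

theorem RetargetsAt.four_le_dist {t : ℕ} (h : RetargetsAt G x y t) : 4 ≤ G.dist (y t) (x t) := by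
  obtain ⟨_, h1, ⟨i, hi⟩, h2⟩ := h
  have : stage2End G x y + 4 * i = t := by omega
  simpa [this] using h2 i this.le

theorem StillRetargeting.of_block {t u : ℕ} (h : StillRetargeting G x y t)
    (h4 : 4 ∣ t - stage2End G x y) (h2 : stage2End G x y ≤ t) (hu : u < t + 4) :
    StillRetargeting G x y u := by
  intro i hi
  obtain ⟨j, hj⟩ := h4
  exact h i (by omega)

theorem RetargetsAt.dist_add_four_eq {t : ℕ} (h : RetargetsAt G x y t)
    (hF : FollowsFourStages G x y) (hf : FreeAt x y (t + 4)) :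
    G.dist (y (t + 4)) (x t) + 4 = G.dist (y t) (x t) := by
  obtain ⟨_, h1, h2, h3⟩ := h
  refine dist_add_eq_of_stepsToward fun u hu hu' => ?_
  have h4 := hF.stage3 u (hf.mono hu'.le) (h1.trans hu) (h3.of_block h2 h1 hu')
  have h5 : stage2End G x y + 4 * ((u - stage2End G x y) / 4) = t := by omega
  rwa [h5] at h4

theorem dist_le_of_adj_succ (hG : G.Connected) (hx : ∀ t, G.Adj (x t) (x (t + 1))) (t k : ℕ) :
    G.dist (x t) (x (t + k)) ≤ k := by
  induction k with
  | zero => simp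
  | succ k ih => exact (dist_le_succ_of_adj hG _ (hx (t + k))).trans (by omega)

open scoped Classical in
/-- At the retargeting moments the distance of the players decreases, by the end of each block in
which the robber has not moved away by four. -/
theorem retarget_potential_step (hG : G.Connected) (hF : FollowsFourStages G x y)
    (hx : ∀ t, G.Adj (x t) (x (t + 1))) (t : ℕ) :
    (if RetargetsAt G x y (t + 4) then G.dist (y (t + 4)) (x (t + 4)) else 0) +
        (if RetargetsAt G x y t ∧ G.dist (x t) (x (t + 4)) ≤ 3 then 1 else 0) ≤
      (if RetargetsAt G x y t then G.dist (y t) (x t) else 0) +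
        (if stage2End G x y = t + 4 ∧ FreeAt x y (t + 4) then
          G.dist (y (t + 4)) (x (t + 4)) else 0) := by
  by_cases h4 : RetargetsAt G x y (t + 4)
  · by_cases hs : stage2End G x y = t + 4
    · have h0 : ¬ RetargetsAt G x y t := fun h => by have := h.2.1; omega
      simp [h4, h0, hs, h4.1]
    · have h0 : RetargetsAt G x y t := by
        obtain ⟨h1, h2, ⟨i, hi⟩, h3⟩ := h4
        have : i ≠ 0 := fun h => hs (by subst h; omega)
        exact ⟨h1.mono (by omega), by omega, ⟨i - 1, by omega⟩, h3.mono (by omega)⟩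
      -- The cop gains four towards `x t`; the robber takes back at most four, and at most three
      -- when the block is counted.
      have h1 := h0.dist_add_four_eq hF h4.1
      have h2 := hG.dist_triangle (u := y (t + 4)) (v := x t) (w := x (t + 4))
      have h3 := dist_le_of_adj_succ hG hx t 4
      rw [if_pos h4, if_pos h0]
      split_ifs <;> omega
  · rw [if_neg h4]
    by_cases h0 : RetargetsAt G x y t
    -- No retargeting follows: the old distance, at least four, pays for the last gain.
    · have := h0.four_le_dist
      rw [if_pos h0]
      split_ifs <;> omega
    · simp [h0]

open scoped Classical in
-- `retarget_potential_step` telescopes in all residue classes modulo four at once. The potential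
-- enters only at the end of Stage 2, where the cop stands on the robber's position from the end of
-- Stage 1.
theorem sum_retarget_gain_le (hG : G.Connected) (hF : FollowsFourStages G x y)
    (hx : ∀ t, G.Adj (x t) (x (t + 1))) (N : ℕ) :
    ∑ t ∈ Finset.range N, (if RetargetsAt G x y t ∧ G.dist (x t) (x (t + 4)) ≤ 3 then 1 else 0) ≤
      G.dist (x (stage1End G x y))
        (x (stage1End G x y + G.dist (x 0) (x (stage1End G x y)))) := by
  set z : ℕ → ℕ := fun t => if RetargetsAt G x y t then G.dist (y t) (x t) else 0 with hz
  set w : ℕ → ℕ := fun t => if stage2End G x y = t ∧ FreeAt x y t then G.dist (y t) (x t) else 0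
    with hw
  have h1 : ∑ t ∈ Finset.range N, z (t + 4) + ∑ t ∈ Finset.range N,
      (if RetargetsAt G x y t ∧ G.dist (x t) (x (t + 4)) ≤ 3 then 1 else 0) ≤
      ∑ t ∈ Finset.range N, z t + ∑ t ∈ Finset.range N, w (t + 4) := by
    rw [← Finset.sum_add_distrib, ← Finset.sum_add_distrib]
    exact Finset.sum_le_sum fun t _ => retarget_potential_step hG hF hx t
  -- A retargeting moment below four has no block before it, so it is the end of Stage 2.
  have h2 : ∑ t ∈ Finset.range 4, z t ≤ ∑ t ∈ Finset.range 4, w t := by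
    refine Finset.sum_le_sum fun t ht => ?_
    simp only [hz, hw]
    by_cases h0 : RetargetsAt G x y t
    · have h3 : stage2End G x y = t := by
        obtain ⟨_, h2, ⟨i, hi⟩, _⟩ := h0
        have := Finset.mem_range.1 ht
        omega
      rw [if_pos h0, if_pos ⟨h3, h0.1⟩]
    · simp [h0]
  have h3 : ∑ t ∈ Finset.range N, z t ≤
      ∑ t ∈ Finset.range 4, z t + ∑ t ∈ Finset.range N, z (t + 4) := by
    have := Finset.sum_range_add z 4 N
    simp only [add_comm _ 4]
    rw [← this]
    exact Finset.sum_le_sum_of_subset (Finset.range_mono (by omega))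
  have h4 : ∑ t ∈ Finset.range 4, w t + ∑ t ∈ Finset.range N, w (t + 4) ≤
      G.dist (x (stage1End G x y))
        (x (stage1End G x y + G.dist (x 0) (x (stage1End G x y)))) := by
    simp only [add_comm _ 4]
    rw [← Finset.sum_range_add w 4 N]
    refine (Finset.sum_le_sum (g := fun t => if stage2End G x y = t then
      G.dist (x (stage1End G x y))
        (x (stage1End G x y + G.dist (x 0) (x (stage1End G x y)))) else 0) fun t _ => ?_).trans ?_
    · simp only [hw]
      by_cases ht : stage2End G x y = t ∧ FreeAt x y t
      · obtain ⟨rfl, hf⟩ := ht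
        rw [if_pos ⟨rfl, hf⟩, if_pos rfl, hF.cop_stage2End hG hf,
          hF.stage2End_eq hG (hf.mono stage1End_le_stage2End)]
      · rw [if_neg ht]
        exact Nat.zero_le _
    · rw [Finset.sum_ite_eq]
      split_ifs
      exacts [le_rfl, Nat.zero_le _]
  omega

/-- Each greedy step shortens the distance by at least one, and the robber's reply restores at most
one. -/
theorem FollowsFourStages.dist_le_three (hG : G.Connected) (hF : FollowsFourStages G x y)
    (hx : ∀ t, G.Adj (x t) (x (t + 1))) {t : ℕ} (hf : FreeAt x y t) (h4 : InStageFour G x y t) :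
    G.dist (y t) (x t) ≤ 3 := by
  obtain ⟨_, h⟩ := h4
  unfold StillRetargeting at h
  push Not at h
  obtain ⟨i, hi, hd⟩ := h
  obtain ⟨k, rfl⟩ := Nat.exists_eq_add_of_le hi
  clear hi
  set u := stage2End G x y + 4 * i with hu
  have hs : ∀ j, InStageFour G x y (u + j) := fun j =>
    ⟨by omega, fun h1 => absurd (h1 i (by omega)) (not_le.2 hd)⟩
  induction k with
  | zero => rw [add_zero]; omega
  | succ k ih =>
    have hfk : FreeAt x y (u + k) := hf.mono (by omega)
    have h1 := ih hfk
    have h2 := (hF.stage4 _ hfk (hs k).1 (hs k).2).dist_add_one_le hG hfk.ne.symm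
    have h3 := dist_le_succ_of_adj hG (y (u + k + 1)) (hx (u + k))
    rw [← add_assoc u k 1]
    omega

/-- The greedy step leaves distance at most two, so the robber's neighbour on a geodesic to the cop
is within one of her. -/
theorem SurvivesGreedyAt.exists_adj_dist_le_one (hG : G.Connected) (hF : FollowsFourStages G x y)
    (hx : ∀ t, G.Adj (x t) (x (t + 1))) {t : ℕ} (h : SurvivesGreedyAt G x y t) :
    ∃ b, G.Adj (x t) b ∧ G.dist (y (t + 1)) b ≤ 1 := by
  obtain ⟨hf, h4, hne⟩ := h
  have h1 := hF.dist_le_three hG hx hf h4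
  have h2 := (hF.stage4 _ hf h4.1 h4.2).dist_add_one_le hG hf.ne.symm
  obtain ⟨b, hb, hb'⟩ := exists_adj_dist_add_one_eq hG hne.symm
  refine ⟨b, hb, ?_⟩
  rw [G.dist_comm (u := x t), G.dist_comm (u := b)] at hb'
  omega

open scoped Classical in
theorem sum_survivesGreedy_near_le (hG : G.Connected) (hF : FollowsFourStages G x y) (N : ℕ) :
    ∑ t ∈ Finset.range N,
      (if SurvivesGreedyAt G x y t ∧ G.dist (y (t + 1)) (x (t + 1)) ≤ 1 then 1 else 0) ≤ 1 := by
  -- `q` takes the values zero and one and never increases. It drops at each counted move, since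
  -- from distance one the next greedy step lands on the robber.
  set q : ℕ → ℕ := fun t =>
    (if SurvivesGreedyAt G x y t then 1 else 0) + (if InStageFour G x y t then 0 else 1) with hq
  have hq1 : ∀ t, q t ≤ 1 := fun t => by
    simp only [hq]
    by_cases h : InStageFour G x y t
    · split_ifs <;> omega
    · have : ¬ SurvivesGreedyAt G x y t := fun h1 => h h1.2.1
      simp [h, this]
  have step : ∀ t, q (t + 1) +
      (if SurvivesGreedyAt G x y t ∧ G.dist (y (t + 1)) (x (t + 1)) ≤ 1 then 1 else 0) ≤ q t := by
    intro t
    by_cases h : InStageFour G x y t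
    · have h' := h.mono (Nat.le_add_right t 1)
      simp only [hq, if_pos h, if_pos h', add_zero]
      by_cases h1 : SurvivesGreedyAt G x y (t + 1)
      · have h0 : SurvivesGreedyAt G x y t :=
          ⟨h1.1.mono (by omega), h, h1.1.ne_of_succ⟩
        have h2 : ¬ G.dist (y (t + 1)) (x (t + 1)) ≤ 1 := fun h2 => by
          have h3 := (hF.stage4 _ h1.1 h'.1 h'.2).dist_add_one_le hG h1.1.ne.symm
          exact h1.2.2 (hG.dist_eq_zero_iff.1 (by omega))
        simp [h0, h1, h2]
      · by_cases h0 : SurvivesGreedyAt G x y t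
        · simp only [if_neg h1, h0, true_and, if_true]
          split_ifs <;> omega
        · simp [h0, h1]
    · have h0 : ¬ SurvivesGreedyAt G x y t := fun h1 => h h1.2.1
      have h1 := hq1 (t + 1)
      have h2 : q t = 1 := by simp [hq, h, h0]
      simp only [h0, false_and, if_false, h2]
      omega
  have : ∀ N, q N + ∑ t ∈ Finset.range N,
      (if SurvivesGreedyAt G x y t ∧ G.dist (y (t + 1)) (x (t + 1)) ≤ 1 then 1 else 0) ≤ q 0 := by
    intro N
    induction N with
    | zero => simp
    | succ N ih =>
      rw [Finset.sum_range_succ]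
      have := step N
      omega
  have h1 := this N
  have h2 := hq1 0
  omega

theorem sum_range_shift (f : ℕ → ℕ) (j N : ℕ) :
    ∑ t ∈ Finset.range N, (if j ≤ t then f (t - j) else 0) = ∑ t ∈ Finset.range (N - j), f t := by
  induction N with
  | zero => simp
  | succ N ih =>
    rw [Finset.sum_range_succ, ih]
    split_ifs with h
    · rw [Nat.succ_sub h, Finset.sum_range_succ]
    · have h1 : N + 1 - j = 0 := by omega
      have h2 : N - j = 0 := by omega
      simp [h1, h2]

open scoped Classical in
-- A greedy move counted on the left but not on the right catches the robber, so there is at most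
-- one.
theorem sum_stageFour_le (N : ℕ) :
    ∑ t ∈ Finset.range N, (if FreeAt x y t ∧ InStageFour G x y t then 1 else 0) ≤
      ∑ t ∈ Finset.range N, (if SurvivesGreedyAt G x y t then 1 else 0) + 1 := by
  have : ∀ N, ∑ t ∈ Finset.range N, (if FreeAt x y t ∧ InStageFour G x y t then 1 else 0) +
      (if FreeAt x y N then 1 else 0) ≤
      ∑ t ∈ Finset.range N, (if SurvivesGreedyAt G x y t then 1 else 0) + 1 := by
    intro N
    induction N with
    | zero => simp only [Finset.range_zero, Finset.sum_empty]; split_ifs <;> omega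
    | succ N ih =>
      rw [Finset.sum_range_succ, Finset.sum_range_succ]
      by_cases h1 : FreeAt x y (N + 1)
      · have h0 : FreeAt x y N := h1.mono (by omega)
        have h2 : FreeAt x y N ∧ InStageFour G x y N → SurvivesGreedyAt G x y N :=
          fun h => ⟨h.1, h.2, h1.ne_of_succ⟩
        simp only [h1, h0, if_true] at ih ⊢
        split_ifs <;> first | omega | (exfalso; tauto)
      · simp only [h1, if_false]
        by_cases h0 : FreeAt x y N
        · simp only [h0, if_true] at ih
          split_ifs <;> omega
        · simp only [h0, if_false, false_and] at ih ⊢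
          omega
  exact (Nat.le_add_right _ _).trans (this N)

open scoped Classical in
/-- The moves before the capture, counted by stages. -/
theorem sum_freeAt_le (hG : G.Connected) (hF : FollowsFourStages G x y) (N : ℕ) :
    ∑ t ∈ Finset.range N, (if FreeAt x y t then 1 else 0) ≤
      stage1End G x y + G.dist (x 0) (x (stage1End G x y)) +
        4 * ∑ t ∈ Finset.range N, (if RetargetsAt G x y t then 1 else 0) +
        ∑ t ∈ Finset.range N, (if SurvivesGreedyAt G x y t then 1 else 0) + 1 := by
  set m := stage1End G x y with hm
  have h1 : ∀ t, (if FreeAt x y t then 1 else 0) ≤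
      (if t < m + G.dist (x 0) (x m) then 1 else 0) +
      ∑ j ∈ Finset.range 4, (if j ≤ t then if RetargetsAt G x y (t - j) then 1 else 0 else 0) +
      (if FreeAt x y t ∧ InStageFour G x y t then 1 else 0) := by
    intro t
    by_cases hf : FreeAt x y t
    · by_cases h2 : t < m + G.dist (x 0) (x m)
      · rw [if_pos hf, if_pos h2]; omega
      · by_cases h4 : InStageFour G x y t
        · rw [if_pos hf, if_pos (show FreeAt x y t ∧ InStageFour G x y t from ⟨hf, h4⟩)]; omega
        · have hs : stage2End G x y ≤ t := by
            have h5 := hF.stage2End_eq hG (hf.mono (by omega))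
            rw [← hm] at h5
            omega
          have hst : StillRetargeting G x y t := by
            by_contra h
            exact h4 ⟨hs, h⟩
          -- `t - j` is the retargeting moment of the block containing `t`.
          set j := (t - stage2End G x y) % 4 with hj
          have hR : RetargetsAt G x y (t - j) :=
            ⟨hf.mono (by omega), by omega, by omega, hst.mono (by omega)⟩
          have h5 : (1 : ℕ) ≤ ∑ j ∈ Finset.range 4,
              (if j ≤ t then if RetargetsAt G x y (t - j) then 1 else 0 else 0) := by
            refine le_trans (le_of_eq ?_) (Finset.single_le_sum (f := fun j =>
              if j ≤ t then if RetargetsAt G x y (t - j) then 1 else 0 else 0)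
              (fun _ _ => Nat.zero_le _) (Finset.mem_range.2 (show j < 4 by omega)))
            rw [if_pos (by omega), if_pos hR]
          rw [if_pos hf]
          omega
    · rw [if_neg hf]; omega
  refine (Finset.sum_le_sum fun t _ => h1 t).trans ?_
  rw [Finset.sum_add_distrib, Finset.sum_add_distrib, Finset.sum_comm]
  simp only [sum_range_shift fun t => if RetargetsAt G x y t then 1 else 0]
  have h2 : ∑ t ∈ Finset.range N, (if t < m + G.dist (x 0) (x m) then 1 else 0) ≤
      m + G.dist (x 0) (x m) := by
    rw [← Finset.card_filter]
    refine (Finset.card_le_card (t := Finset.range (m + G.dist (x 0) (x m))) fun t ht => ?_).trans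
      (Finset.card_range _).le
    simpa using (Finset.mem_filter.1 ht).2
  have h3 : ∑ j ∈ Finset.range 4, ∑ t ∈ Finset.range (N - j),
      (if RetargetsAt G x y t then 1 else 0) ≤
      4 * ∑ t ∈ Finset.range N, (if RetargetsAt G x y t then 1 else 0) := by
    refine (Finset.sum_le_card_nsmul _ _ _ fun j _ =>
      Finset.sum_le_sum_of_subset (Finset.range_mono (Nat.sub_le N j))).trans ?_
    simp
  have h4 := sum_stageFour_le (G := G) (x := x) (y := y) N
  omega

end Plays

/-! ### Stage events depend only on the past -/

section Determined

variable {V : Type*} {G : SimpleGraph V} {x y x' y' : ℕ → V} {t : ℕ}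

theorem FreeAt.congr (hX : ∀ s ≤ t, x s = x' s) (hY : ∀ s ≤ t + 1, y s = y' s)
    (h : FreeAt x y t) : FreeAt x' y' t := by
  rintro s hs (h1 | ⟨u, rfl, h1⟩)
  · exact h s hs (Or.inl (by rw [hX s hs, hY s (by omega), h1]))
  · exact h _ hs (Or.inr ⟨u, rfl, by rw [hX u (by omega), hY _ (by omega), h1]⟩)

/-- Once Stage 2 is over, all positions that determine its end lie in the past. -/
theorem stage2End_congr (hX : ∀ s ≤ t, x s = x' s) (hY : ∀ s ≤ t + 1, y s = y' s)
    (h : stage2End G x y ≤ t) : stage2End G x' y' = stage2End G x y := by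
  have h1 := (stage1End_le_stage2End (G := G) (x := x) (y := y)).trans h
  have h2 : stage1End G x' y' = stage1End G x y := by
    unfold stage1End
    rw [hX 0 (by omega), hY 0 (by omega)]
  unfold stage2End
  rw [h2, hX _ h1, hY _ (by omega)]

theorem stillRetargeting_congr (hX : ∀ s ≤ t, x s = x' s) (hY : ∀ s ≤ t + 1, y s = y' s)
    (h : stage2End G x y ≤ t) (h' : StillRetargeting G x y t) : StillRetargeting G x' y' t := by
  intro i hi
  rw [stage2End_congr hX hY h] at hi ⊢
  rw [← hX _ hi, ← hY _ (by omega)]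
  exact h' i hi

theorem RetargetsAt.congr (hX : ∀ s ≤ t, x s = x' s) (hY : ∀ s ≤ t + 1, y s = y' s)
    (h : RetargetsAt G x y t) : RetargetsAt G x' y' t := by
  obtain ⟨h1, h2, h3, h4⟩ := h
  have h5 := stage2End_congr (G := G) hX hY h2
  exact ⟨h1.congr hX hY, h5 ▸ h2, h5 ▸ h3, stillRetargeting_congr hX hY h2 h4⟩

theorem SurvivesGreedyAt.congr (hX : ∀ s ≤ t, x s = x' s) (hY : ∀ s ≤ t + 1, y s = y' s)
    (h : SurvivesGreedyAt G x y t) : SurvivesGreedyAt G x' y' t := by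
  obtain ⟨h1, ⟨h2, h3⟩, h4⟩ := h
  have h5 := stage2End_congr (G := G) hX hY h2
  refine ⟨h1.congr hX hY, ⟨h5 ▸ h2, fun h6 => h3 ?_⟩, ?_⟩
  · exact stillRetargeting_congr (fun s hs => (hX s hs).symm) (fun s hs => (hY s hs).symm)
      (h5 ▸ h2) h6
  · rw [← hX t le_rfl, ← hY _ le_rfl]
    exact h4

end Determined

section Games

variable {V Ω : Type*} {G : SimpleGraph V} {X Y : ℕ → Ω → V}

theorem determinedAt_freeAt (t : ℕ) :
    DeterminedAt X Y t fun ω => FreeAt (fun s => X s ω) (fun s => Y s ω) t :=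
  fun _ _ hX hY => propext ⟨fun h => h.congr hX hY,
    fun h => h.congr (fun s hs => (hX s hs).symm) fun s hs => (hY s hs).symm⟩

theorem determinedAt_retargetsAt (t : ℕ) :
    DeterminedAt X Y t fun ω => RetargetsAt G (fun s => X s ω) (fun s => Y s ω) t :=
  fun _ _ hX hY => propext ⟨fun h => h.congr hX hY,
    fun h => h.congr (fun s hs => (hX s hs).symm) fun s hs => (hY s hs).symm⟩

theorem determinedAt_survivesGreedyAt (t : ℕ) :
    DeterminedAt X Y t fun ω => SurvivesGreedyAt G (fun s => X s ω) (fun s => Y s ω) t :=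
  fun _ _ hX hY => propext ⟨fun h => h.congr hX hY,
    fun h => h.congr (fun s hs => (hX s hs).symm) fun s hs => (hY s hs).symm⟩

end Games

/-! ### Expected lengths of the stages -/

theorem lintegral_sum_ite {Ω : Type*} [MeasurableSpace Ω] {P : Measure Ω} {A : ℕ → Ω → Prop}
    [∀ t ω, Decidable (A t ω)]
    (hA : ∀ t, MeasurableSet {ω | A t ω}) (N : ℕ) :
    ∫⁻ ω, ((∑ t ∈ Finset.range N, if A t ω then 1 else 0 : ℕ) : ℝ≥0∞) ∂P =
      ∑ t ∈ Finset.range N, P {ω | A t ω} := by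
  have h1 : ∀ t ω, (if A t ω then (1 : ℝ≥0∞) else 0) = {ω | A t ω}.indicator 1 ω := fun t ω => by
    simp [Set.indicator_apply]
  simp only [Nat.cast_sum, Nat.cast_ite, Nat.cast_one, Nat.cast_zero, h1]
  rw [lintegral_finsetSum _ fun t _ => measurable_one.indicator (hA t)]
  simp only [lintegral_indicator_one (hA _)]

theorem measurable_sum_ite {Ω : Type*} [MeasurableSpace Ω] {A : ℕ → Ω → Prop}
    [∀ t ω, Decidable (A t ω)]
    (hA : ∀ t, MeasurableSet {ω | A t ω}) (N : ℕ) :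
    Measurable fun ω => ((∑ t ∈ Finset.range N, if A t ω then 1 else 0 : ℕ) : ℝ≥0∞) := by
  simp only [Nat.cast_sum, Nat.cast_ite, Nat.cast_one, Nat.cast_zero]
  exact Finset.measurable_fun_sum _ fun t _ =>
    Measurable.ite (hA t) measurable_const measurable_const

namespace IsDrunkGame

variable {V Ω : Type*} [Fintype V] {G : SimpleGraph V} [DecidableRel G.Adj] [MeasurableSpace Ω]
  {P : Measure Ω} {X Y : ℕ → Ω → V} {r c : V}

theorem measurable_robber_comp (h : IsDrunkGame G P X Y r c) {β : Type*} [MeasurableSpace β]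
    [Nonempty β] (t u : ℕ) (g : V → V → β) : Measurable fun ω => g (X t ω) (X u ω) :=
  h.measurable_of_determinedAt (t := max t u)
    ((determinedAt_robber (le_max_left _ _)).comp₂ (determinedAt_robber (le_max_right _ _)) g)

theorem expectedCaptureTime_le_tsum (h : IsDrunkGame G P X Y r c) :
    expectedCaptureTime P X Y ≤
      ∑' t, P {ω | FreeAt (fun s => X s ω) (fun s => Y s ω) t} := by
  classical
  have hA : ∀ t, MeasurableSet {ω | FreeAt (fun s => X s ω) (fun s => Y s ω) t} := fun t =>
    h.measurableSet_of_determinedAt (determinedAt_freeAt t)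
  refine (lintegral_mono fun ω => captureTime_le_tsum _ _).trans (le_of_eq ?_)
  rw [lintegral_tsum fun t => (Measurable.ite (hA t) measurable_const measurable_const).aemeasurable]
  refine tsum_congr fun t => ?_
  rw [← lintegral_indicator_one (hA t)]
  exact lintegral_congr fun ω => by simp [Set.indicator_apply]

/-- If, on an event `A` known at time `t`, the walk is at time `t + k` in a ball known at time `t`
with conditional probability at least `p`, then this happens with probability at least `p * P A`. -/
theorem ofReal_mul_measure_le (h : IsDrunkGame G P X Y r c) (hdeg : ∀ a, 0 < G.degree a)
    {t : ℕ} (k i : ℕ) {A : Ω → Prop} (hA : DeterminedAt X Y t A) {Z : Ω → V}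
    (hZ : DeterminedAt X Y t Z) {p : ℝ}
    (hp : ∀ᵐ ω ∂P, A ω → p ≤ (walkAvg G)^[k] (ballInd G (Z ω) i) (X t ω)) :
    ENNReal.ofReal p * P {ω | A ω} ≤ P {ω | A ω ∧ G.dist (Z ω) (X (t + k) ω) ≤ i} := by
  have hAm := h.measurableSet_of_determinedAt hA
  have hN : MeasurableSet {ω | G.dist (Z ω) (X (t + k) ω) ≤ i} :=
    h.measurableSet_of_determinedAt (t := t + k)
      ((hZ.mono (by omega)).comp₂ (determinedAt_robber le_rfl) fun a b => G.dist a b ≤ i)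
  have h1 := h.setLIntegral_robber_steps hdeg k hA (F := fun ω => ballInd G (Z ω) i)
    (hZ.comp fun z => ballInd G z i) fun ω b => ballInd_nonneg _ _ _
  calc ENNReal.ofReal p * P {ω | A ω} = ∫⁻ _ in {ω | A ω}, ENNReal.ofReal p ∂P := by
        rw [setLIntegral_const]
    _ ≤ ∫⁻ ω in {ω | A ω},
          ENNReal.ofReal ((walkAvg G)^[k] (ballInd G (Z ω) i) (X t ω)) ∂P := by
        refine lintegral_mono_ae ((ae_restrict_iff' hAm).2 ?_)
        filter_upwards [hp] with ω hω hA' using ENNReal.ofReal_le_ofReal (hω hA')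
    _ = ∫⁻ ω in {ω | A ω}, {ω | G.dist (Z ω) (X (t + k) ω) ≤ i}.indicator 1 ω ∂P := by
        rw [← h1]
        refine lintegral_congr fun ω => ?_
        by_cases hω : G.dist (Z ω) (X (t + k) ω) ≤ i <;> simp [ballInd, hω]
    _ = P {ω | A ω ∧ G.dist (Z ω) (X (t + k) ω) ≤ i} := by
        rw [lintegral_indicator_one hN, Measure.restrict_apply hN, Set.inter_comm]
        rfl

theorem lintegral_dist_start_le [IsProbabilityMeasure P] (h : IsDrunkGame G P X Y r c)
    (hdeg : ∀ a, 0 < G.degree a) (t : ℕ) {d : ℝ}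
    (hd : (walkAvg G)^[t] (fun b => (G.dist r b : ℝ)) r ≤ d) :
    ∫⁻ ω, (G.dist r (X t ω) : ℝ≥0∞) ∂P ≤ ENNReal.ofReal d := by
  have h1 := h.lintegral_robber_steps hdeg (t := 0) t (F := fun _ b => (G.dist r b : ℝ))
    (fun _ _ _ _ => rfl) fun _ _ => Nat.cast_nonneg _
  simp only [zero_add, ENNReal.ofReal_natCast, h.robber_start, lintegral_const, measure_univ,
    mul_one] at h1
  rw [h1]
  exact ENNReal.ofReal_le_ofReal hd

/-- The displacement of the robber between time `m` and `m + d(r, X m)`. -/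
theorem lintegral_dist_second_le (h : IsDrunkGame G P X Y r c) [IsProbabilityMeasure P]
    (hG : G.Connected) (hdeg : ∀ a, 0 < G.degree a) (m : ℕ) {a b d : ℝ} (ha : 0 ≤ a) (hb : 0 ≤ b)
    (hab : ∀ (k : ℕ) (x : V), (walkAvg G)^[k] (fun v => (G.dist x v : ℝ)) x ≤ a + b * k)
    (hd0 : 0 ≤ d) (hd : ∫⁻ ω, (G.dist r (X m ω) : ℝ≥0∞) ∂P ≤ ENNReal.ofReal d) :
    ∫⁻ ω, (G.dist (X m ω) (X (m + G.dist r (X m ω)) ω) : ℝ≥0∞) ∂P ≤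
      ENNReal.ofReal (a + b * d) := by
  classical
  have := hG.nonempty
  have hdiam : ∀ v, G.dist r v ∈ Finset.range (G.diam + 1) := fun v =>
    Finset.mem_range.2 (Nat.lt_succ_of_le
      (SimpleGraph.dist_le_diam (SimpleGraph.connected_iff_ediam_ne_top.1 hG)))
  have hD : ∀ k, DeterminedAt X Y m fun ω => G.dist r (X m ω) = k := fun k =>
    (determinedAt_robber le_rfl).comp fun v => G.dist r v = k
  have hDm : ∀ k, MeasurableSet {ω | G.dist r (X m ω) = k} := fun k =>
    h.measurableSet_of_determinedAt (hD k)
  -- The number of further steps is random but known at time `m` and at most the diameter, so the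
  -- integral is split by its value.
  have e : ∀ f : ℕ → Ω → ℝ≥0∞, ∀ ω, f (G.dist r (X m ω)) ω =
      ∑ k ∈ Finset.range (G.diam + 1), {ω | G.dist r (X m ω) = k}.indicator (f k) ω := by
    intro f ω
    simp only [Set.indicator_apply, Set.mem_ofPred_eq]
    rw [Finset.sum_ite_eq, if_pos (hdiam _)]
  have e' : ∀ f : ℕ → Ω → ℝ≥0∞, (∀ k, Measurable (f k)) →
      ∫⁻ ω, f (G.dist r (X m ω)) ω ∂P =
        ∑ k ∈ Finset.range (G.diam + 1), ∫⁻ ω in {ω | G.dist r (X m ω) = k}, f k ω ∂P := by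
    intro f hf
    simp only [e f]
    rw [lintegral_finsetSum _ fun k _ => (hf k).indicator (hDm k)]
    simp only [lintegral_indicator (hDm _)]
  rw [e' (fun k ω => (G.dist (X m ω) (X (m + k) ω) : ℝ≥0∞)) fun k =>
    h.measurable_robber_comp m (m + k) fun u v => (G.dist u v : ℝ≥0∞)]
  calc _ = ∑ k ∈ Finset.range (G.diam + 1), ∫⁻ ω in {ω | G.dist r (X m ω) = k},
          ENNReal.ofReal ((walkAvg G)^[k] (fun v => (G.dist (X m ω) v : ℝ)) (X m ω)) ∂P := by
        refine Finset.sum_congr rfl fun k _ => ?_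
        rw [← h.setLIntegral_robber_steps hdeg k (hD k)
          (F := fun ω v => (G.dist (X m ω) v : ℝ))
          ((determinedAt_robber le_rfl).comp fun u v => (G.dist u v : ℝ))
          fun _ _ => Nat.cast_nonneg _]
        simp only [ENNReal.ofReal_natCast]
    _ ≤ ∑ k ∈ Finset.range (G.diam + 1), ∫⁻ _ in {ω | G.dist r (X m ω) = k},
          ENNReal.ofReal (a + b * k) ∂P :=
        Finset.sum_le_sum fun k _ => lintegral_mono fun ω => ENNReal.ofReal_le_ofReal (hab k _)
    -- As the bound is affine in the number of steps, only the expectation of that number enters.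
    _ = ∫⁻ ω, ENNReal.ofReal (a + b * G.dist r (X m ω)) ∂P :=
        (e' (fun k _ => ENNReal.ofReal (a + b * k)) fun k => measurable_const).symm
    _ = ENNReal.ofReal a + ENNReal.ofReal b * ∫⁻ ω, (G.dist r (X m ω) : ℝ≥0∞) ∂P := by
        have : ∀ ω, ENNReal.ofReal (a + b * G.dist r (X m ω)) =
            ENNReal.ofReal a + ENNReal.ofReal b * (G.dist r (X m ω) : ℝ≥0∞) := fun ω => by
          rw [ENNReal.ofReal_add ha (by positivity), ENNReal.ofReal_mul hb, ENNReal.ofReal_natCast]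
        simp only [this]
        rw [lintegral_add_left measurable_const, lintegral_const, measure_univ, mul_one,
          lintegral_const_mul _
            (h.measurable_robber_comp m m fun u _ => (G.dist r u : ℝ≥0∞))]
    _ ≤ ENNReal.ofReal a + ENNReal.ofReal b * ENNReal.ofReal d := by gcongr
    _ = _ := by rw [← ENNReal.ofReal_mul hb, ENNReal.ofReal_add ha (by positivity)]

/-- Each block is a gain with conditional probability at least `p`, and the number of gains is at
most the distance at the start of Stage 3. -/
theorem sum_measure_retargetsAt_le (h : IsDrunkGame G P X Y r c)
    (hF : ∀ ω, FollowsFourStages G (fun t => X t ω) (fun t => Y t ω))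
    (hG : G.Connected) (hdeg : ∀ a, 0 < G.degree a) {p : ℝ} (hp0 : 0 < p)
    (hp : ∀ x, p ≤ (walkAvg G)^[4] (ballInd G x 3) x) {d : ℝ}
    (hd : ∫⁻ ω, (G.dist (X (G.dist c r) ω)
      (X (G.dist c r + G.dist r (X (G.dist c r) ω)) ω) : ℝ≥0∞) ∂P ≤ ENNReal.ofReal d) (N : ℕ) :
    ∑ t ∈ Finset.range N, P {ω | RetargetsAt G (fun s => X s ω) (fun s => Y s ω) t} ≤
      ENNReal.ofReal (d / p) := by
  classical
  have hm : ∀ t, MeasurableSet {ω | RetargetsAt G (fun s => X s ω) (fun s => Y s ω) t ∧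
      G.dist (X t ω) (X (t + 4) ω) ≤ 3} := fun t =>
    (h.measurableSet_of_determinedAt (determinedAt_retargetsAt t)).inter
      (measurableSet_setOfPred.2 (h.measurable_robber_comp t (t + 4) fun u v => G.dist u v ≤ 3))
  have h1 : ENNReal.ofReal p *
      ∑ t ∈ Finset.range N, P {ω | RetargetsAt G (fun s => X s ω) (fun s => Y s ω) t} ≤
      ENNReal.ofReal d := by
    calc _ ≤ ∑ t ∈ Finset.range N, P {ω | RetargetsAt G (fun s => X s ω) (fun s => Y s ω) t ∧
            G.dist (X t ω) (X (t + 4) ω) ≤ 3} := by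
          rw [Finset.mul_sum]
          exact Finset.sum_le_sum fun t _ => h.ofReal_mul_measure_le hdeg 4 3
            (determinedAt_retargetsAt t) (determinedAt_robber le_rfl)
            (Eventually.of_forall fun ω _ => hp _)
      _ ≤ ∫⁻ ω, (G.dist (X (G.dist c r) ω)
            (X (G.dist c r + G.dist r (X (G.dist c r) ω)) ω) : ℝ≥0∞) ∂P := by
          rw [← lintegral_sum_ite hm]
          refine lintegral_mono_ae ?_
          filter_upwards [h.ae_adj] with ω hω
          have := sum_retarget_gain_le hG (hF ω) hω N
          simp only [stage1End, h.robber_start, h.cop_start] at this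
          exact_mod_cast this
      _ ≤ _ := hd
  rw [ENNReal.ofReal_div_of_pos hp0, ENNReal.le_div_iff_mul_le (Or.inl (by simpa using hp0))
    (Or.inl ENNReal.ofReal_ne_top), mul_comm]
  exact h1

/-- After each survived greedy step the robber moves to within one of the cop with conditional
probability at least `1 / Δ`, and this happens at most once in a play. -/
theorem sum_measure_survivesGreedyAt_le [IsProbabilityMeasure P] (h : IsDrunkGame G P X Y r c)
    (hF : ∀ ω, FollowsFourStages G (fun t => X t ω) (fun t => Y t ω))
    (hG : G.Connected) (hdeg : ∀ a, 0 < G.degree a) (N : ℕ) :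
    ∑ t ∈ Finset.range N, P {ω | SurvivesGreedyAt G (fun s => X s ω) (fun s => Y s ω) t} ≤
      ENNReal.ofReal G.maxDegree := by
  classical
  have hD : (0 : ℝ) < G.maxDegree := by
    exact_mod_cast (hdeg r).trans_le (G.degree_le_maxDegree r)
  have hY : ∀ t, DeterminedAt X Y t (Y (t + 1)) := fun t _ _ _ hY => hY _ le_rfl
  have hm : ∀ t, MeasurableSet {ω | SurvivesGreedyAt G (fun s => X s ω) (fun s => Y s ω) t ∧
      G.dist (Y (t + 1) ω) (X (t + 1) ω) ≤ 1} := fun t =>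
    (h.measurableSet_of_determinedAt (determinedAt_survivesGreedyAt t)).inter
      (h.measurableSet_of_determinedAt (t := t + 1)
        (((hY t).mono (by omega)).comp₂ (determinedAt_robber le_rfl) fun u v => G.dist u v ≤ 1))
  have h1 : ENNReal.ofReal (G.maxDegree : ℝ)⁻¹ *
      ∑ t ∈ Finset.range N, P {ω | SurvivesGreedyAt G (fun s => X s ω) (fun s => Y s ω) t} ≤
      1 := by
    calc _ ≤ ∑ t ∈ Finset.range N,
            P {ω | SurvivesGreedyAt G (fun s => X s ω) (fun s => Y s ω) t ∧
            G.dist (Y (t + 1) ω) (X (t + 1) ω) ≤ 1} := by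
          rw [Finset.mul_sum]
          refine Finset.sum_le_sum fun t _ => h.ofReal_mul_measure_le hdeg 1 1
            (determinedAt_survivesGreedyAt t) (hY t) ?_
          filter_upwards [h.ae_adj] with ω hω hs
          obtain ⟨b, hb, hb'⟩ := hs.exists_adj_dist_le_one hG (hF ω) hω
          have h2 : (1 : ℝ) ≤ ∑ b ∈ G.neighborFinset (X t ω), ballInd G (Y (t + 1) ω) 1 b := by
            have h3 : ballInd G (Y (t + 1) ω) 1 b = 1 := if_pos hb'
            rw [← h3]
            exact Finset.single_le_sum (f := ballInd G (Y (t + 1) ω) 1)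
              (fun b _ => ballInd_nonneg _ _ _) (by simpa using hb)
          have h4 : (0 : ℝ) < G.degree (X t ω) := by exact_mod_cast hdeg _
          have h5 : (G.degree (X t ω) : ℝ) ≤ G.maxDegree := by
            exact_mod_cast G.degree_le_maxDegree _
          rw [inv_eq_one_div]
          exact div_le_div₀ (zero_le_one.trans h2) h2 h4 h5
      _ ≤ ∫⁻ _, 1 ∂P := by
          rw [← lintegral_sum_ite hm]
          refine lintegral_mono_ae (Eventually.of_forall fun ω => ?_)
          have := sum_survivesGreedy_near_le hG (hF ω) N
          exact_mod_cast this
      _ = 1 := by simp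
  rw [ENNReal.ofReal_inv_of_pos hD, ENNReal.inv_mul_le_iff (ENNReal.ofReal_pos.2 hD).ne'
    ENNReal.ofReal_ne_top, mul_one] at h1
  exact h1

theorem expectedCaptureTime_le [IsProbabilityMeasure P] (h : IsDrunkGame G P X Y r c)
    (hF : ∀ ω, FollowsFourStages G (fun t => X t ω) (fun t => Y t ω))
    (hG : G.Connected) (hdeg : ∀ a, 0 < G.degree a) {p : ℝ} (hp0 : 0 < p)
    (hp : ∀ x, p ≤ (walkAvg G)^[4] (ballInd G x 3) x) {d₁ d₂ : ℝ} (hd₁0 : 0 ≤ d₁) (hd₂0 : 0 ≤ d₂)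
    (hd₁ : ∫⁻ ω, (G.dist r (X (G.dist c r) ω) : ℝ≥0∞) ∂P ≤ ENNReal.ofReal d₁)
    (hd₂ : ∫⁻ ω, (G.dist (X (G.dist c r) ω)
      (X (G.dist c r + G.dist r (X (G.dist c r) ω)) ω) : ℝ≥0∞) ∂P ≤ ENNReal.ofReal d₂) :
    expectedCaptureTime P X Y ≤
      ENNReal.ofReal (G.dist c r + d₁ + 4 * (d₂ / p) + G.maxDegree + 1) := by
  classical
  refine h.expectedCaptureTime_le_tsum.trans (ENNReal.tsum_le_of_sum_range_le fun N => ?_)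
  have hfree := fun t => h.measurableSet_of_determinedAt (determinedAt_freeAt (X := X) (Y := Y) t)
  have hret := fun t => h.measurableSet_of_determinedAt
    (determinedAt_retargetsAt (G := G) (X := X) (Y := Y) t)
  have hsur := fun t => h.measurableSet_of_determinedAt
    (determinedAt_survivesGreedyAt (G := G) (X := X) (Y := Y) t)
  rw [← lintegral_sum_ite hfree]
  calc _ ≤ ∫⁻ ω, ((G.dist c r : ℝ≥0∞) + (G.dist r (X (G.dist c r) ω) : ℝ≥0∞) +
          4 * ((∑ t ∈ Finset.range N,
            if RetargetsAt G (fun s => X s ω) (fun s => Y s ω) t then 1 else 0 : ℕ) : ℝ≥0∞) +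
          ((∑ t ∈ Finset.range N,
            if SurvivesGreedyAt G (fun s => X s ω) (fun s => Y s ω) t then 1 else 0 : ℕ) : ℝ≥0∞) +
          1) ∂P := by
        refine lintegral_mono_ae (Eventually.of_forall fun ω => ?_)
        have := sum_freeAt_le hG (hF ω) N
        simp only [stage1End, h.robber_start, h.cop_start] at this
        exact_mod_cast this
    _ = (G.dist c r : ℝ≥0∞) + ∫⁻ ω, (G.dist r (X (G.dist c r) ω) : ℝ≥0∞) ∂P +
          4 * ∑ t ∈ Finset.range N, P {ω | RetargetsAt G (fun s => X s ω) (fun s => Y s ω) t} +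
          ∑ t ∈ Finset.range N,
            P {ω | SurvivesGreedyAt G (fun s => X s ω) (fun s => Y s ω) t} + 1 := by
        rw [lintegral_add_right _ measurable_const,
          lintegral_add_right _ (measurable_sum_ite hsur N),
          lintegral_add_right _ ((measurable_sum_ite hret N).const_mul 4),
          lintegral_add_left measurable_const,
          lintegral_const_mul _ (measurable_sum_ite hret N),
          lintegral_sum_ite hret, lintegral_sum_ite hsur]
        simp
    _ ≤ ENNReal.ofReal (G.dist c r) + ENNReal.ofReal d₁ + ENNReal.ofReal 4 *
          ENNReal.ofReal (d₂ / p) + ENNReal.ofReal G.maxDegree + ENNReal.ofReal 1 := by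
        rw [ENNReal.ofReal_natCast (G.dist c r), ENNReal.ofReal_one,
          show ENNReal.ofReal 4 = 4 by simp]
        gcongr
        · exact h.sum_measure_retargetsAt_le hF hG hdeg hp0 hp hd₂ N
        · exact h.sum_measure_survivesGreedyAt_le hF hG hdeg N
    _ = _ := by
        rw [← ENNReal.ofReal_mul (by norm_num), ← ENNReal.ofReal_add (by positivity) hd₁0,
          ← ENNReal.ofReal_add (by positivity) (by positivity),
          ← ENNReal.ofReal_add (by positivity) (by positivity),
          ← ENNReal.ofReal_add (by positivity) (by positivity)]

end IsDrunkGame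

/-! ### The error term and the final assembly -/

/-- The error term of the bound on the expected capture time. -/
noncomputable def captureError (n : ℕ) : ℝ :=
  4 + (Real.log n + 9) * (n : ℝ) ^ (1 / 2 : ℝ) +
    (84 * Real.log n + 766) * (n : ℝ) ^ (11 / 12 : ℝ)

theorem isLittleO_log_mul_rpow (a b : ℝ) {γ : ℝ} (hγ : γ < 1) :
    (fun n : ℕ => (a * Real.log n + b) * (n : ℝ) ^ γ) =o[atTop] fun n : ℕ => (n : ℝ) := by
  have h0 : 0 < 1 - γ := by linarith
  have h1 : (fun x : ℝ => a * Real.log x + b) =o[atTop] fun x : ℝ => x ^ (1 - γ) := by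
    refine ((isLittleO_log_rpow_atTop h0).const_mul_left a).add ?_
    refine isLittleO_const_left.2 (Or.inr ?_)
    exact tendsto_norm_atTop_atTop.comp (tendsto_rpow_atTop h0)
  have h2 := (h1.mul_isBigO (isBigO_refl (fun x : ℝ => x ^ γ) atTop)).comp_tendsto
    tendsto_natCast_atTop_atTop
  refine h2.congr' EventuallyEq.rfl ?_
  filter_upwards [eventually_gt_atTop 0] with n hn
  have hn' : (0 : ℝ) < n := by exact_mod_cast hn
  simp only [Function.comp_apply]
  rw [← Real.rpow_add hn', sub_add_cancel, Real.rpow_one]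

theorem captureError_isLittleO : captureError =o[atTop] fun n : ℕ => (n : ℝ) := by
  have h₁ := isLittleO_log_mul_rpow 1 9 (γ := 1 / 2) (by norm_num)
  simp only [one_mul] at h₁
  refine (IsLittleO.add ?_ h₁).add
    (isLittleO_log_mul_rpow 84 766 (by norm_num))
  refine isLittleO_const_left.2 (Or.inr ?_)
  exact tendsto_norm_atTop_atTop.comp tendsto_natCast_atTop_atTop

/-- Both phases of the diffusive estimate, with the parameters optimised. -/
theorem captureError_ge {n : ℕ} (hn : 1 ≤ n) {m d₁ d₂ : ℝ} (hm : m ≤ n)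
    (hd₁ : d₁ = (Real.log n + 1) / (n : ℝ) ^ (-(1 / 2) : ℝ) + 8 * (n : ℝ) ^ (-(1 / 2) : ℝ) * m + 1)
    (hd₂ : d₂ = (Real.log n + 1) / (n : ℝ) ^ (-(1 / 4) : ℝ) + 1 +
      8 * (n : ℝ) ^ (-(1 / 4) : ℝ) * d₁) :
    d₁ + 4 * (d₂ / (3 / 7 * (n : ℝ) ^ (-(2 / 3) : ℝ))) + 3 ≤ captureError n := by
  have hn1 : (1 : ℝ) ≤ n := by exact_mod_cast hn
  have hn0 : (0 : ℝ) < n := by linarith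
  have hL : 0 ≤ Real.log n := Real.log_nonneg hn1
  have e1 : (n : ℝ) ^ (-(1 / 2) : ℝ) * n = (n : ℝ) ^ (1 / 2 : ℝ) := by
    rw [← Real.rpow_add_one hn0.ne']; norm_num
  have e2 : (n : ℝ) ^ (-(1 / 4) : ℝ) * (n : ℝ) ^ (1 / 2 : ℝ) = (n : ℝ) ^ (1 / 4 : ℝ) := by
    rw [← Real.rpow_add hn0]; norm_num
  have e3 : (n : ℝ) ^ (1 / 4 : ℝ) * (n : ℝ) ^ (2 / 3 : ℝ) = (n : ℝ) ^ (11 / 12 : ℝ) := by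
    rw [← Real.rpow_add hn0]; norm_num
  have i1 : (1 : ℝ) ≤ (n : ℝ) ^ (1 / 4 : ℝ) := Real.one_le_rpow hn1 (by norm_num)
  have i2 : (n : ℝ) ^ (-(1 / 4) : ℝ) ≤ 1 := Real.rpow_le_one_of_one_le_of_nonpos hn1 (by norm_num)
  have hq : 0 < (n : ℝ) ^ (2 / 3 : ℝ) := Real.rpow_pos_of_pos hn0 _
  have hs : 0 < (n : ℝ) ^ (-(1 / 2) : ℝ) := Real.rpow_pos_of_pos hn0 _
  have hs' : 0 < (n : ℝ) ^ (-(1 / 4) : ℝ) := Real.rpow_pos_of_pos hn0 _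
  have k1 : (Real.log n + 1) / (n : ℝ) ^ (-(1 / 2) : ℝ) =
      (Real.log n + 1) * (n : ℝ) ^ (1 / 2 : ℝ) := by
    rw [Real.rpow_neg hn0.le, div_inv_eq_mul]
  have k2 : (Real.log n + 1) / (n : ℝ) ^ (-(1 / 4) : ℝ) =
      (Real.log n + 1) * (n : ℝ) ^ (1 / 4 : ℝ) := by
    rw [Real.rpow_neg hn0.le, div_inv_eq_mul]
  have k3 : d₂ / (3 / 7 * (n : ℝ) ^ (-(2 / 3) : ℝ)) = 7 / 3 * (d₂ * (n : ℝ) ^ (2 / 3 : ℝ)) := by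
    rw [Real.rpow_neg hn0.le]
    field_simp
  have b1 : d₁ ≤ (Real.log n + 9) * (n : ℝ) ^ (1 / 2 : ℝ) + 1 := by
    rw [hd₁, k1]
    have := mul_le_mul_of_nonneg_left hm hs.le
    rw [e1] at this
    linarith
  have b2 : d₂ ≤ (9 * Real.log n + 82) * (n : ℝ) ^ (1 / 4 : ℝ) := by
    rw [hd₂, k2]
    have h1 := mul_le_mul_of_nonneg_left b1 hs'.le
    have h2 : (n : ℝ) ^ (-(1 / 4) : ℝ) * ((Real.log n + 9) * (n : ℝ) ^ (1 / 2 : ℝ) + 1) =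
        (Real.log n + 9) * (n : ℝ) ^ (1 / 4 : ℝ) + (n : ℝ) ^ (-(1 / 4) : ℝ) := by
      rw [← e2]; ring
    rw [h2] at h1
    linarith
  have b3 : d₂ * (n : ℝ) ^ (2 / 3 : ℝ) ≤ (9 * Real.log n + 82) * (n : ℝ) ^ (11 / 12 : ℝ) := by
    rw [← e3, ← mul_assoc]
    exact mul_le_mul_of_nonneg_right b2 hq.le
  have hp : 0 < (n : ℝ) ^ (11 / 12 : ℝ) := Real.rpow_pos_of_pos hn0 _
  -- The factor `4 * (7 / 3)` turns `9` into `84` and `82` into less than `766`; the constant `4` is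
  -- the `1` of `b1` plus the `3` of the claim.
  rw [k3, captureError]
  linarith

theorem expectedCaptureTime_eq_zero {V Ω : Type*} [MeasurableSpace Ω] {P : Measure Ω}
    {X Y : ℕ → Ω → V} (h : ∀ ω, X 0 ω = Y 0 ω) : expectedCaptureTime P X Y = 0 := by
  have : ∀ ω, captureTime (fun t => X t ω) (fun t => Y t ω) = 0 := fun ω =>
    le_antisymm (iInf₂_le (0 : ℕ) (Or.inl (h ω))) zero_le
  simp [expectedCaptureTime, this]

/-- The spare `2` absorbs the loss in `diam_add_maxDegree_le`, so that one error term serves both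
bounds. -/
theorem IsDrunkGame.expectedCaptureTime_add_two_le {V Ω : Type*} [Fintype V] {G : SimpleGraph V}
    [DecidableRel G.Adj] [MeasurableSpace Ω] {P : Measure Ω} [IsProbabilityMeasure P]
    {X Y : ℕ → Ω → V} {r c : V} (h : IsDrunkGame G P X Y r c) (hG : G.Connected)
    (hF : ∀ ω, FollowsFourStages G (fun t => X t ω) (fun t => Y t ω)) (hrc : r ≠ c) :
    expectedCaptureTime P X Y ≤
      ENNReal.ofReal (G.diam + G.maxDegree + (captureError (Fintype.card V) - 2)) := by
  have : Nontrivial V := ⟨r, c, hrc⟩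
  have hdeg : ∀ a, 0 < G.degree a := fun a => hG.preconnected.degree_pos_of_nontrivial a
  set n := Fintype.card V with hn
  have hn1 : 1 ≤ n := Fintype.card_pos
  have hn0 : (0 : ℝ) < n := by exact_mod_cast hn1
  have hL : 0 ≤ Real.log n := Real.log_natCast_nonneg n
  set m := G.dist c r with hm
  have hm' : m ≤ G.diam :=
    SimpleGraph.dist_le_diam (SimpleGraph.connected_iff_ediam_ne_top.1 hG)
  have hdiam : G.diam ≤ n := by
    obtain ⟨u, hu⟩ := exists_dist_eq_of_le_diam hG
    choose v hv using hu
    have h1 := Fintype.card_le_of_injective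
      (fun j : Fin G.diam => v j j.2.le) fun i j hij => Fin.ext (by
        rw [← hv i i.2.le, ← hv j j.2.le]
        exact congrArg (G.dist u) hij)
    rwa [Fintype.card_fin] at h1
  have hmn : (m : ℝ) ≤ n := by exact_mod_cast hm'.trans hdiam
  -- `s₁` suits the at most `n` moves of Stage 1, and `s₂` the roughly `√n` moves of Stage 2. A
  -- deterministic `s₂` keeps the second bound affine in the number of steps.
  set s₁ := (n : ℝ) ^ (-(1 / 2) : ℝ) with hs₁
  set s₂ := (n : ℝ) ^ (-(1 / 4) : ℝ) with hs₂
  set q := (n : ℝ) ^ (-(2 / 3) : ℝ) with hq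
  have hs₁0 : 0 < s₁ := Real.rpow_pos_of_pos hn0 _
  have hs₂0 : 0 < s₂ := Real.rpow_pos_of_pos hn0 _
  have hq0 : 0 < q := Real.rpow_pos_of_pos hn0 _
  have hqn : q ^ 3 * (n : ℝ) ^ 2 = 1 := by
    rw [hq, ← Real.rpow_natCast, ← Real.rpow_mul hn0.le, ← Real.rpow_natCast (n : ℝ) 2,
      ← Real.rpow_add hn0]
    norm_num
  set d₁ := (Real.log n + 1) / s₁ + 8 * s₁ * m + 1 with hd₁
  set d₂ := (Real.log n + 1) / s₂ + 1 + 8 * s₂ * d₁ with hd₂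
  have hd₁0 : 0 ≤ d₁ := by positivity
  have hd₂0 : 0 ≤ d₂ := by positivity
  have b₁ := h.lintegral_dist_start_le hdeg m (walkAvg_iterate_dist_le hG hdeg hs₁0 m r)
  have b₂ := h.lintegral_dist_second_le hG hdeg m (a := (Real.log n + 1) / s₂ + 1) (b := 8 * s₂)
    (by positivity) (by positivity)
    (fun k x => (walkAvg_iterate_dist_le hG hdeg hs₂0 k x).trans (by linarith)) hd₁0 b₁
  refine (h.expectedCaptureTime_le hF hG hdeg (p := 3 / 7 * q) (by positivity)
    (walkAvg_iterate_four_ballInd_ge hG hdeg hq0 hqn) hd₁0 hd₂0 b₁ b₂).trans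
    (ENNReal.ofReal_le_ofReal ?_)
  have h1 := captureError_ge hn1 hmn hd₁ hd₂
  have h2 : (m : ℝ) ≤ G.diam := by exact_mod_cast hm'
  linarith

end DrunkRobber

theorem theorem3p6 :
    ∃ f : ℕ → ℝ, f =o[atTop] (fun n : ℕ => (n : ℝ)) ∧
      ∀ (V : Type*) [Fintype V] (G : SimpleGraph V) [DecidableRel G.Adj], G.Connected →
      ∀ (Ω : Type*) [MeasurableSpace Ω] (P : Measure Ω) [IsProbabilityMeasure P]
        (X Y : ℕ → Ω → V) (r c : V),
        DrunkRobber.IsDrunkGame G P X Y r c →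
        (∀ ω, DrunkRobber.FollowsFourStages G (fun t => X t ω) (fun t => Y t ω)) →
        DrunkRobber.expectedCaptureTime P X Y
            ≤ ENNReal.ofReal ((G.diam : ℝ) + (G.maxDegree : ℝ) + f (Fintype.card V)) ∧
          DrunkRobber.expectedCaptureTime P X Y
            ≤ ENNReal.ofReal ((Fintype.card V : ℝ) + f (Fintype.card V)) := by
  refine ⟨DrunkRobber.captureError, DrunkRobber.captureError_isLittleO, ?_⟩
  intro V _ G _ hG Ω _ P _ X Y r c h hF
  -- Equal starting vertices give capture time zero; distinct ones make all degrees positive, as the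
  -- walk estimates need.
  by_cases hrc : r = c
  · have h0 : ∀ ω, X 0 ω = Y 0 ω := fun ω => by rw [h.robber_start, h.cop_start, hrc]
    rw [DrunkRobber.expectedCaptureTime_eq_zero h0]
    exact ⟨zero_le, zero_le⟩
  · have h1 := h.expectedCaptureTime_add_two_le hG hF hrc
    have h2 : (G.diam : ℝ) + G.maxDegree ≤ Fintype.card V + 2 := by
      exact_mod_cast DrunkRobber.diam_add_maxDegree_le hG
    exact ⟨h1.trans (ENNReal.ofReal_le_ofReal (by linarith)),
      h1.trans (ENNReal.ofReal_le_ofReal (by linarith))⟩
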